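/- A *1-periodic graph* is a graph $G$ (loops and multiple edges allowed, no isolated vertices), with a sign $\sigma_e=\pm1$ on every edge $e$, together with a free action of the infinite cyclic group $\langle x\rangle$ by sign-preserving automorphisms whose quotient graph $\overline G$ is finite. Choose a representative $v_{1,0},\dots,v_{n,0}$ of each vertex orbit and put $v_{i,k}=x^k v_{i,0}$. The *Laplacian matrix* of $G$ is the $n\times n$ matrix $L_G=\delta-A$ over $\mathbb Z[x,x^{-1}]$, where $\delta$ is the diagonal matrix whose entry $\delta_{i,i}$ is the sum of the signs of the edges incident to $v_{i,0}$ (loops counted twice), and $A_{i,j}$ is the sum of the monomials $\sigma_e x^{k}$ over all edges $e$ joining $v_{i,0}$ to $v_{j,k}$, $k\in\mathbb Z$ (a loop of $\overline G$ contributes two diagonal terms with inverse monomials). The *Laplacian polynomial* is $\Delta_G=\det L_G\in\mathbb Z[x,x^{-1}]$. $G$ is *plane* if it is embedded in an infinite strip $I\times\mathbb R\subset\mathbb R^2$ on which $x$ acts by a translation along the strip, so that $\overline G$ is embedded in an annulus. The *medial construction* associates with such a $G$ a diagram $D$ of a (possibly infinite) link $\ell$: every edge of $G$ is replaced by two segments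 that run parallel to it, one on each side, except that they cross in its middle, the sign of the edge determining which of the two is the overcrossing strand; near the vertices the segments are joined without further crossings. A component of $\ell$ is *closed* if it is a simple closed curve (and not a line). A *2-coloring* of $D$ is an assignment of elements of $\mathbb Z/2$ to the arcs of $D$ such that at each crossing twice the color of the overcrossing arc equals the sum of the colors of the two undercrossing arcs; the 2-colorings form a group under arc-wise addition. **Proposition.** Let $G$ be a plane 1-periodic graph, $D$ its associated link diagram and $\ell$ the associated link. The following are equivalent. 1. The link $\ell$ has closed components (that is, at least one). 2. The group of 2-colorings of $D$ is infinite. 3. The Laplacian polynomial $\Delta_G$ reduced modulo $2$ is identically zero. -/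

import Mathlib

/-- A signed 1-periodic graph `G` with vertex set `V`, described by its set `D` of darts (edges with
a chosen direction): every edge of `G` is a pair `{d, rev d}`, and the dart `d` runs from `tail d`
to `tail (rev d)`. Loops and multiple edges are allowed, isolated vertices are not.
The generator `x` of the infinite cyclic group acts by `shiftV` and `shiftD`. The action on the
vertices is free; then it is free on darts and on edges as well, since `shiftD ^ n` sending `d` to
`d` or to `rev d` makes `shiftV ^ (2 * n)` fix `tail d`. The quotient graph is finite. -/
structure PeriodicGraph (V D : Type*) where
  tail : D → V
  rev : Equiv.Perm D
  rev_rev : ∀ d, rev (rev d) = d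
  rev_ne : ∀ d, rev d ≠ d
  no_isolated : Function.Surjective tail
  sign : D → ℤˣ
  sign_rev : ∀ d, sign (rev d) = sign d
  shiftV : Equiv.Perm V
  shiftD : Equiv.Perm D
  tail_shift : ∀ d, tail (shiftD d) = shiftV (tail d)
  rev_shift : ∀ d, rev (shiftD d) = shiftD (rev d)
  sign_shift : ∀ d, sign (shiftD d) = sign d
  free : ∀ (n : ℤ) (v : V), (shiftV ^ n) v = v → n = 0
  finite_vertexOrbits : Finite (Quotient (Equiv.Perm.SameCycle.setoid shiftV))
  finite_dartOrbits : Finite (Quotient (Equiv.Perm.SameCycle.setoid shiftD))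

namespace PeriodicGraph

variable {V D : Type*} (G : PeriodicGraph V D)

/-- Vertices of the quotient graph: orbits of vertices under the cyclic group. -/
abbrev VertexOrbit : Type _ := Quotient (Equiv.Perm.SameCycle.setoid G.shiftV)

/-- Darts of the quotient graph: orbits of darts under the cyclic group. -/
abbrev DartOrbit : Type _ := Quotient (Equiv.Perm.SameCycle.setoid G.shiftD)

instance : Finite G.VertexOrbit := G.finite_vertexOrbits

instance : Finite G.DartOrbit := G.finite_dartOrbits

noncomputable instance : Fintype G.VertexOrbit := Fintype.ofFinite _

noncomputable instance : Fintype G.DartOrbit := Fintype.ofFinite _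

/-- The orbit `i` of a vertex `v`. -/
def vertexOrbit (v : V) : G.VertexOrbit := Quotient.mk _ v

theorem exists_level (v : V) :
    ∃ n : ℤ, (G.shiftV ^ n) (Quotient.out (G.vertexOrbit v)) = v :=
  Quotient.mk_out (s := Equiv.Perm.SameCycle.setoid G.shiftV) v

/-- With one chosen vertex `v_{i,0}` in every orbit `i`, every vertex is
`v_{i,n} = x ^ n • v_{i,0}` for a unique `n`, its level. -/
noncomputable def level (v : V) : ℤ := (G.exists_level v).choose

/-- For a dart from `v_{i,m}` to `v_{j,m+n}` (so that a translate of it runs from `v_{i,0}` to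
`v_{j,n}`), this is `n`. -/
noncomputable def voltage (d : D) : ℤ := G.level (G.tail (G.rev d)) - G.level (G.tail d)

open Classical in
/-- The adjacency matrix over `ℤ[x, x⁻¹]`: its entry `(i, j)` is the sum of `sign e * x ^ n` over
the edges `e` of the quotient graph that lift to an edge joining `v_{i,0}` to `v_{j,n}`. Both darts
of an edge are counted, so that a loop of the quotient graph contributes the two diagonal terms
`sign e * x ^ n` and `sign e * x ^ (-n)`. -/
noncomputable def adjacency : Matrix G.VertexOrbit G.VertexOrbit (LaurentPolynomial ℤ) :=
  fun i j => ∑ q : G.DartOrbit,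
    if G.vertexOrbit (G.tail q.out) = i ∧ G.vertexOrbit (G.tail (G.rev q.out)) = j then
      LaurentPolynomial.C ((G.sign q.out : ℤˣ) : ℤ) * LaurentPolynomial.T (G.voltage q.out)
    else 0

open Classical in
/-- The signed degree of a vertex: the sum of the signs of the incident edges, loops twice. -/
noncomputable def signedDegree (i : G.VertexOrbit) : ℤ :=
  ∑ q : G.DartOrbit, if G.vertexOrbit (G.tail q.out) = i then ((G.sign q.out : ℤˣ) : ℤ) else 0

open Classical in
/-- The Laplacian matrix: signed degree matrix minus adjacency matrix. -/
noncomputable def laplacian : Matrix G.VertexOrbit G.VertexOrbit (LaurentPolynomial ℤ) :=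
  Matrix.diagonal (fun i => LaurentPolynomial.C (G.signedDegree i)) - G.adjacency

open Classical in
/-- The Laplacian polynomial. It does not depend on the choice of the vertices `v_{i,0}`, as another
choice conjugates the Laplacian matrix by a diagonal matrix of monomials. -/
noncomputable def laplacianPolynomial : LaurentPolynomial ℤ := G.laplacian.det

end PeriodicGraph

/-- A plane 1-periodic graph: a 1-periodic graph drawn in an infinite strip on which `x` acts as a
translation, so that the finite quotient graph is drawn in the annulus. The drawing is recorded by
its rotation system: `rot d` is the dart that follows `d` in counterclockwise order around
`tail d`. The face permutation `d ↦ rot (rev d)` follows the boundary of the face on the right of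
`d`, up to the turn at the end of each dart.

`euler` is Euler's formula `#V - #E + #F = 2 * #components` for the quotient graph; every connected
component has `#V - #E + #F ≤ 2`, so it says that every component is drawn on a sphere. The annulus
is the sphere with two punctures, and the strip is its infinite cyclic cover. A boundary walk in the
quotient therefore winds around the annulus `0` times, except, if the two punctures lie in different
faces of a component, for the boundary walk of the one face (winding number `1`) and that of the other
(winding number `-1`). The last three fields express this in the cover. -/
structure PlanePeriodicGraph (V D : Type*) extends PeriodicGraph V D where
  rot : Equiv.Perm D
  tail_eq_iff : ∀ d e, tail d = tail e ↔ rot.SameCycle d e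
  rot_shift : ∀ d, rot (shiftD d) = shiftD (rot d)
  euler :
    Nat.card (Quotient (Equiv.Perm.SameCycle.setoid shiftV)) +
      Nat.card (MulAction.orbitRel.Quotient (Subgroup.closure {shiftD, rot * rev}) D) =
    Nat.card (MulAction.orbitRel.Quotient (Subgroup.closure {shiftD, rev}) D) +
      2 * Nat.card (MulAction.orbitRel.Quotient (Subgroup.closure {shiftD, rot, rev}) D)
  winding : ∀ d, ∃ k : ℕ, 0 < k ∧
    (((rot * rev) ^ k) d = d ∨ ((rot * rev) ^ k) d = shiftD d ∨
      ((rot * rev) ^ k) d = shiftD.symm d)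
  upward_unique : ∀ d e, d ∈ MulAction.orbit (Subgroup.closure {rot, rev}) e →
    (∃ k : ℕ, 0 < k ∧ ((rot * rev) ^ k) d = shiftD d) →
    (∃ k : ℕ, 0 < k ∧ ((rot * rev) ^ k) e = shiftD e) → (rot * rev).SameCycle d e
  downward_unique : ∀ d e, d ∈ MulAction.orbit (Subgroup.closure {rot, rev}) e →
    (∃ k : ℕ, 0 < k ∧ ((rot * rev) ^ k) d = shiftD.symm d) →
    (∃ k : ℕ, 0 < k ∧ ((rot * rev) ^ k) e = shiftD.symm e) → (rot * rev).SameCycle d e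

/-- A (possibly infinite) link diagram, without components free of crossings, described by the set
`H` of half-edges of its underlying 4-valent graph. Around a crossing the four half-edges follow
each other counterclockwise under `next`; the edges are the pairs `{h, mate h}`; and `isOver h` tells
whether `h` belongs to the overcrossing strand of its crossing. The strand that arrives at a crossing
along `h` leaves it along the opposite half-edge `next (next h)`. -/
structure LinkDiagram (H : Type*) where
  next : Equiv.Perm H
  next_four : ∀ h, next (next (next (next h))) = h
  next_two_ne : ∀ h, next (next h) ≠ h
  mate : Equiv.Perm H
  mate_mate : ∀ h, mate (mate h) = h
  mate_ne : ∀ h, mate h ≠ h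
  isOver : H → Prop
  isOver_next : ∀ h, isOver (next h) ↔ ¬ isOver h

namespace LinkDiagram

variable {H : Type*} (L : LinkDiagram H)

/-- The arcs of the diagram, as sets of half-edges: an arc continues along edges and through
crossings where it lies on the overcrossing strand, and it breaks at its undercrossings. -/
def Arc : Type _ := Quot fun h h₁ : H => h₁ = L.mate h ∨ (L.isOver h ∧ h₁ = L.next (L.next h))

/-- The arc to which a half-edge belongs. -/
def arc (h : H) : L.Arc := Quot.mk _ h

/-- The components of the link, as sets of half-edges: a component continues along edges and
straight through all crossings. -/
def Component : Type _ := Quot fun h h₁ : H => h₁ = L.mate h ∨ h₁ = L.next (L.next h)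

/-- The component to which a half-edge belongs. -/
def component (h : H) : L.Component := Quot.mk _ h

/-- One step of the journey along a component: leave a crossing along `h`, arrive at the next
crossing along `mate h`, and pass straight through it. -/
def step (h : H) : H := L.next (L.next (L.mate h))

variable {L} in
/-- A component is closed (a simple closed curve, and not a line) if the journey along it returns to
a half-edge that it started from. -/
def Component.IsClosed (K : L.Component) : Prop :=
  ∃ h : H, L.component h = K ∧ ∃ k : ℕ, 0 < k ∧ L.step^[k] h = h

/-- The group of Fox colorings of the diagram by elements of an abelian group `A`: at every crossing,
twice the color of the overcrossing arc is the sum of the colors of the undercrossing arcs. For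
`A = ZMod p` these are the Fox `p`-colorings. -/
def colorings (A : Type*) [AddCommGroup A] : AddSubgroup (L.Arc → A) where
  carrier := {c | ∀ h, L.isOver h →
    2 • c (L.arc h) = c (L.arc (L.next h)) + c (L.arc (L.next.symm h))}
  zero_mem' := by intro h _; simp
  add_mem' := by
    intro a b ha hb h ho
    simp only [Pi.add_apply, smul_add, ha h ho, hb h ho]
    abel
  neg_mem' := by
    intro a ha h ho
    simp only [Pi.neg_apply, smul_neg, ha h ho]
    abel

end LinkDiagram

namespace PlanePeriodicGraph

variable {V D : Type*} (G : PlanePeriodicGraph V D)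

/-- The link diagram associated with `G` by the medial construction. Every edge of `G` is replaced by
two segments that run parallel to it and cross in its middle. The half-edges at that crossing are
`(d, true)` and `(d, false)`, for the two darts `d` of the edge: the halves near `tail d`, on the left
and on the right of `d`. In counterclockwise order they are
`(d, true)`, `(d, false)`, `(rev d, true)`, `(rev d, false)`.
Near a vertex, the segment on the left of `d` is joined to the one on the right of `rot d`.
The sign of the edge tells which of the two strands is the overcrossing one. -/
def medialDiagram : LinkDiagram (D × Bool) where
  next :=
    { toFun := fun h => if h.2 then (h.1, false) else (G.rev h.1, true)
      invFun := fun h => if h.2 then (G.rev h.1, false) else (h.1, true)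
      left_inv := by rintro ⟨d, _ | _⟩ <;> simp [G.rev_rev]
      right_inv := by rintro ⟨d, _ | _⟩ <;> simp [G.rev_rev] }
  next_four := by rintro ⟨d, _ | _⟩ <;> simp [G.rev_rev]
  next_two_ne := by rintro ⟨d, _ | _⟩ <;> simp [G.rev_ne]
  mate :=
    { toFun := fun h => if h.2 then (G.rot h.1, false) else (G.rot.symm h.1, true)
      invFun := fun h => if h.2 then (G.rot h.1, false) else (G.rot.symm h.1, true)
      left_inv := by rintro ⟨d, _ | _⟩ <;> simp
      right_inv := by rintro ⟨d, _ | _⟩ <;> simp }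
  mate_mate := by rintro ⟨d, _ | _⟩ <;> simp
  mate_ne := by rintro ⟨d, _ | _⟩ <;> simp
  isOver := fun h => if h.2 then G.sign h.1 = 1 else G.sign h.1 = -1
  isOver_next := by
    rintro ⟨d, _ | _⟩ <;> rcases Int.units_eq_one_or (G.sign d) with h | h <;>
      simp [G.sign_rev, h]

end PlanePeriodicGraph

/-!
Since the quotient by the translation is finite, a component of the link is closed if and only if
no nontrivial translation carries it to itself. A closed component thus has infinitely many
translates, while there are only finitely many components that wind around the annulus; modulo 2,
the coloring rule says that colors are constant along components, so closed components exist if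
and only if the group of 2-colorings is infinite.

Now let `K` be a field of characteristic 2 and `t` an element of `K` that is not a root of unity.
A function on the components of the link that is multiplied by `t` under the translation vanishes
on the components that wind and is arbitrary on one representative of each orbit of the others.
Hence closed components exist if and only if there is a nonzero function of this kind. In this
local system the annulus has no homology, so by Euler's formula and a count of dimensions every
cycle of `G` is the coboundary of a function on the faces. This makes every such function on the
link a Dehn coloring, the sum of a potential on the vertices and a potential on the faces with the
same coboundary, and the potentials on the vertices that occur are the solutions of `L_G f = 0` at
`x = t`. For `t` transcendental over `ℤ/2`, a nonzero solution exists if and only if `Δ_G`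
vanishes modulo 2.
-/

section Orbits

variable {X : Type*} {s : Equiv.Perm X} {S : Set (Equiv.Perm X)}

theorem apply_zpow_of_semiconj {Y : Type*} {r : Equiv.Perm Y} {f : X → Y}
    (h : ∀ x, f (s x) = r (f x)) (n : ℤ) (x : X) : f ((s ^ n) x) = (r ^ n) (f x) := by
  induction n with
  | zero => simp
  | succ n ih => rw [add_comm, zpow_one_add, zpow_one_add, Equiv.Perm.mul_apply, h, ih,
      Equiv.Perm.mul_apply]
  | pred n ih =>
    rw [← r.injective.eq_iff, ← h, ← Equiv.Perm.mul_apply, ← Equiv.Perm.mul_apply, mul_self_zpow,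
      mul_self_zpow, sub_add_cancel, ih]

theorem zpow_apply_zpow_apply (m n : ℤ) (x : X) : (s ^ m) ((s ^ n) x) = (s ^ (m + n)) x := by
  rw [zpow_add, Equiv.Perm.mul_apply]

theorem apply_zpow_of_commute {σ : Equiv.Perm X} (h : Commute σ s) (n : ℤ) (x : X) :
    σ ((s ^ n) x) = (s ^ n) (σ x) :=
  apply_zpow_of_semiconj (Equiv.congr_fun h.eq) n x

theorem zpow_mul_apply_of_commute {σ : Equiv.Perm X} (hσ : Commute σ s) {k : ℤ} {x : X}
    (h : (s ^ k) x = σ x) (n : ℤ) : (s ^ (k * n)) x = (σ ^ n) x := by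
  have hfix : (σ⁻¹ * s ^ k) x = x := Equiv.Perm.inv_eq_iff_eq.2 h
  have hfix_zpow : ((σ⁻¹ * s ^ k) ^ n) x = x := Function.IsFixedPt.perm_zpow hfix n
  rwa [(hσ.inv_left.zpow_right k).mul_zpow, Equiv.Perm.mul_apply, inv_zpow,
    Equiv.Perm.inv_eq_iff_eq, ← zpow_mul] at hfix_zpow

theorem commute_of_mem_closure (hS : ∀ σ ∈ S, Commute σ s) {γ : Equiv.Perm X}
    (hγ : γ ∈ Subgroup.closure S) : Commute γ s :=
  Subgroup.mem_centralizer_singleton_iff.1 <|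
    (Subgroup.closure_le (Subgroup.centralizer {s})).2
      (fun σ hσ => Subgroup.mem_centralizer_singleton_iff.2 (hS σ hσ)) hγ

theorem mem_closure_insert_iff (hS : ∀ σ ∈ S, Commute σ s) {g : Equiv.Perm X} :
    g ∈ Subgroup.closure (insert s S) ↔ ∃ m : ℤ, ∃ γ ∈ Subgroup.closure S, g = s ^ m * γ := by
  have hs : s ∈ Subgroup.closure (insert s S) := Subgroup.subset_closure (Set.mem_insert _ _)
  constructor
  · intro hg
    induction hg using Subgroup.closure_induction with
    | mem x hx =>
      rcases hx with rfl | hx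
      · exact ⟨1, 1, Subgroup.one_mem _, by simp⟩
      · exact ⟨0, x, Subgroup.subset_closure hx, by simp⟩
    | one => exact ⟨0, 1, Subgroup.one_mem _, by simp⟩
    | mul x y _ _ hx hy =>
      obtain ⟨m, γ, hγ, rfl⟩ := hx
      obtain ⟨n, δ, hδ, rfl⟩ := hy
      have hcomm := (commute_of_mem_closure hS hγ).zpow_right n
      exact ⟨m + n, γ * δ, Subgroup.mul_mem _ hγ hδ, by
        rw [zpow_add, mul_assoc, mul_assoc, hcomm.left_comm]⟩
    | inv x _ hx =>
      obtain ⟨m, γ, hγ, rfl⟩ := hx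
      have hcomm := (commute_of_mem_closure hS hγ).zpow_right m
      exact ⟨-m, γ⁻¹, Subgroup.inv_mem _ hγ, by rw [mul_inv_rev, zpow_neg, hcomm.inv_inv.eq]⟩
  · rintro ⟨m, γ, hγ, rfl⟩
    exact Subgroup.mul_mem _ (Subgroup.zpow_mem _ hs m)
      (Subgroup.closure_mono (Set.subset_insert _ _) hγ)

variable (s S) in
/-- The orbits of the group generated by the translation `s` and by `S`; if `S` commutes with `s`,
they are the orbits of `S` on the quotient by `s`. -/
abbrev JointOrbits : Type _ := MulAction.orbitRel.Quotient (Subgroup.closure (insert s S)) X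

variable (s S) in
/-- The joint orbit of `x`. -/
abbrev jointOrbit (x : X) : JointOrbits s S := Quotient.mk _ x

theorem jointOrbit_eq_iff (hS : ∀ σ ∈ S, Commute σ s) {x y : X} :
    jointOrbit s S y = jointOrbit s S x ↔
      ∃ m : ℤ, ∃ γ ∈ Subgroup.closure S, y = (s ^ m) (γ x) := by
  refine (Quotient.eq.trans MulAction.orbitRel_apply).trans ⟨?_, ?_⟩
  · rintro ⟨⟨g, hg⟩, rfl⟩
    obtain ⟨m, γ, hγ, rfl⟩ := (mem_closure_insert_iff hS).1 hg
    exact ⟨m, γ, hγ, rfl⟩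
  · rintro ⟨m, γ, hγ, rfl⟩
    exact ⟨⟨s ^ m * γ, (mem_closure_insert_iff hS).2 ⟨m, γ, hγ, rfl⟩⟩, rfl⟩

theorem exists_eq_zpow_apply_out (hS : ∀ σ ∈ S, Commute σ s) (x : X) :
    ∃ m : ℤ, ∃ γ ∈ Subgroup.closure S, x = (s ^ m) (γ (jointOrbit s S x).out) :=
  (jointOrbit_eq_iff hS).1 (Quotient.out_eq (jointOrbit s S x)).symm

instance finite_jointOrbits [Finite (Quotient (Equiv.Perm.SameCycle.setoid s))] :
    Finite (JointOrbits s S) := by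
  refine Finite.of_surjective (α := Quotient (Equiv.Perm.SameCycle.setoid s))
    (Quotient.map id ?_) (Quotient.map_surjective _ Function.surjective_id)
  rintro x _ ⟨n, rfl⟩
  exact (MulAction.orbitRel _ _).symm
    ⟨⟨s ^ n, Subgroup.zpow_mem _ (Subgroup.subset_closure (Set.mem_insert _ _)) n⟩, rfl⟩

theorem mem_orbit_closure_singleton {σ : Equiv.Perm X} {x y : X} :
    y ∈ MulAction.orbit (Subgroup.closure {σ}) x ↔ σ.SameCycle x y := by
  constructor
  · rintro ⟨⟨g, hg⟩, rfl⟩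
    obtain ⟨n, rfl⟩ := Subgroup.mem_closure_singleton.1 hg
    exact ⟨n, rfl⟩
  · rintro ⟨n, rfl⟩
    exact ⟨⟨σ ^ n, Subgroup.mem_closure_singleton.2 ⟨n, rfl⟩⟩, rfl⟩

theorem orbit_closure_subset {Y : Set X} (hY : ∀ σ ∈ S, ∀ x, σ x ∈ Y ↔ x ∈ Y) {x : X}
    (hx : x ∈ Y) : MulAction.orbit (Subgroup.closure S) x ⊆ Y := by
  have hmem : ∀ γ ∈ Subgroup.closure S, ∀ x, γ x ∈ Y ↔ x ∈ Y := fun γ hγ => by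
    induction hγ using Subgroup.closure_induction with
    | mem σ hσ => exact hY σ hσ
    | one => exact fun _ => Iff.rfl
    | mul γ δ _ _ hγ hδ => exact fun x => (hγ (δ x)).trans (hδ x)
    | inv γ _ hγ => exact fun x => by rw [← hγ, ← Equiv.Perm.mul_apply, mul_inv_cancel,
        Equiv.Perm.one_apply]
  rintro _ ⟨⟨γ, hγ⟩, rfl⟩
  exact (hmem γ hγ x).2 hx

variable (s S) in
/-- The image in the quotient by the translation `s` of the orbit of `x` under `S` winds around that
quotient: the orbit is carried to itself by some power of `s` other than `s ^ 0`. -/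
def IsWinding (x : X) : Prop :=
  ∃ k : ℤ, k ≠ 0 ∧ (s ^ k) x ∈ MulAction.orbit (Subgroup.closure S) x

theorem IsWinding.mono {S' : Set (Equiv.Perm X)} (h : Subgroup.closure S ≤ Subgroup.closure S')
    {x : X} : IsWinding s S x → IsWinding s S' x := by
  rintro ⟨k, hk, ⟨γ, hγ⟩, hx⟩
  exact ⟨k, hk, ⟨γ, h hγ⟩, hx⟩

theorem IsWinding.of_jointOrbit_eq (hS : ∀ σ ∈ S, Commute σ s) {x y : X}
    (hxy : jointOrbit s S y = jointOrbit s S x) (hx : IsWinding s S x) : IsWinding s S y := by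
  obtain ⟨m, γ, hγ, rfl⟩ := (jointOrbit_eq_iff hS).1 hxy
  obtain ⟨k, hk, ⟨δ, hδ⟩, hkx : δ x = (s ^ k) x⟩ := hx
  have hγδ : γ * δ * γ⁻¹ ∈ Subgroup.closure S :=
    Subgroup.mul_mem _ (Subgroup.mul_mem _ hγ hδ) (Subgroup.inv_mem _ hγ)
  refine ⟨k, hk, ⟨γ * δ * γ⁻¹, hγδ⟩, ?_⟩
  calc (γ * δ * γ⁻¹) ((s ^ m) (γ x))
      = (s ^ m) (γ (δ x)) := by
        rw [apply_zpow_of_commute (commute_of_mem_closure hS hγδ), ← Equiv.Perm.mul_apply _ γ,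
          inv_mul_cancel_right, Equiv.Perm.mul_apply]
    _ = (s ^ k) ((s ^ m) (γ x)) := by
        rw [hkx, apply_zpow_of_commute (commute_of_mem_closure hS hγ), zpow_apply_zpow_apply,
          zpow_apply_zpow_apply, add_comm]

theorem eq_of_zpow_apply_eq_of_not_isWinding (hS : ∀ σ ∈ S, Commute σ s) {x : X}
    (hx : ¬ IsWinding s S x) {γ δ : Equiv.Perm X} (hγ : γ ∈ Subgroup.closure S)
    (hδ : δ ∈ Subgroup.closure S) {m n : ℤ} (h : (s ^ m) (γ x) = (s ^ n) (δ x)) : m = n := by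
  by_contra hne
  refine hx ⟨-n + m, by omega, ⟨γ⁻¹ * δ, Subgroup.mul_mem _ (Subgroup.inv_mem _ hγ) hδ⟩, ?_⟩
  have hshift : γ ((s ^ (-n + m)) x) = δ x := by
    rw [apply_zpow_of_commute (commute_of_mem_closure hS hγ), ← zpow_apply_zpow_apply, h,
      zpow_apply_zpow_apply, neg_add_cancel, zpow_zero, Equiv.Perm.one_apply]
  exact Equiv.Perm.inv_eq_iff_eq.2 hshift.symm

theorem IsWinding.infinite_orbit (hS : ∀ σ ∈ S, Commute σ s) {x : X}
    (hfree : ∀ n : ℤ, (s ^ n) x = x → n = 0) (hx : IsWinding s S x) :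
    (MulAction.orbit (Subgroup.closure S) x).Infinite := by
  obtain ⟨k, hk, ⟨γ, hγ⟩, hkx : γ x = (s ^ k) x⟩ := hx
  refine Set.infinite_of_injective_forall_mem (f := fun n : ℤ => (s ^ (k * n)) x) ?_ fun n => ?_
  · intro m n hmn
    have hdiff : (s ^ (-(k * n) + k * m)) x = x := by
      rw [← zpow_apply_zpow_apply, show (s ^ (k * m)) x = (s ^ (k * n)) x from hmn,
        zpow_apply_zpow_apply, neg_add_cancel, zpow_zero, Equiv.Perm.one_apply]
    have hzero : k * (m - n) = 0 := by linarith [hfree _ hdiff]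
    exact sub_eq_zero.1 ((mul_eq_zero.1 hzero).resolve_left hk)
  · exact ⟨⟨γ ^ n, Subgroup.zpow_mem _ hγ n⟩,
      (zpow_mul_apply_of_commute (commute_of_mem_closure hS hγ) hkx.symm n).symm⟩

theorem finite_orbits_of_forall_isWinding [Finite (JointOrbits s S)]
    (hS : ∀ σ ∈ S, Commute σ s) (h : ∀ x, IsWinding s S x) :
    Finite (MulAction.orbitRel.Quotient (Subgroup.closure S) X) := by
  choose k hk hkx using h
  refine Finite.of_surjective (α := Σ q : JointOrbits s S, Fin (k q.out).natAbs)
    (fun p => Quotient.mk _ ((s ^ (p.2 : ℤ)) p.1.out)) ?_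
  rintro ⟨x⟩
  obtain ⟨m, γ, hγ, hx⟩ := exists_eq_zpow_apply_out hS x
  set q := jointOrbit s S x
  obtain ⟨⟨δ, hδ⟩, hq : δ q.out = (s ^ k q.out) q.out⟩ := hkx q.out
  have hnonneg := Int.emod_nonneg m (hk q.out)
  have hlt := Int.emod_lt_abs m (hk q.out)
  rw [Int.abs_eq_natAbs] at hlt
  set r := m % k q.out with hr
  have hγδ : γ * δ ^ (m / k q.out) ∈ Subgroup.closure S :=
    Subgroup.mul_mem _ hγ (Subgroup.zpow_mem _ hδ _)
  refine ⟨⟨q, ⟨r.toNat, by omega⟩⟩, Quotient.sound ((MulAction.orbitRel _ _).symm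
    ⟨⟨γ * δ ^ (m / k q.out), hγδ⟩, ?_⟩)⟩
  calc (γ * δ ^ (m / k q.out)) ((s ^ ((r.toNat : ℕ) : ℤ)) q.out)
      = (s ^ r) (γ ((s ^ (k q.out * (m / k q.out))) q.out)) := by
        rw [Int.toNat_of_nonneg hnonneg, apply_zpow_of_commute (commute_of_mem_closure hS hγδ),
          zpow_mul_apply_of_commute (commute_of_mem_closure hS hδ) hq.symm, Equiv.Perm.mul_apply]
    _ = x := by
        rw [apply_zpow_of_commute (commute_of_mem_closure hS hγ), zpow_apply_zpow_apply, hr,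
          Int.emod_add_mul_ediv, ← hx]

theorem infinite_orbits_iff_exists_not_isWinding [Finite (JointOrbits s S)]
    (hS : ∀ σ ∈ S, Commute σ s) :
    Infinite (MulAction.orbitRel.Quotient (Subgroup.closure S) X) ↔ ∃ x, ¬ IsWinding s S x := by
  refine ⟨fun hinf => ?_, fun ⟨x, hx⟩ => ?_⟩
  · by_contra! hall
    have := finite_orbits_of_forall_isWinding hS hall
    exact not_finite (MulAction.orbitRel.Quotient (Subgroup.closure S) X)
  · refine Infinite.of_injective (fun n : ℤ => Quotient.mk _ ((s ^ n) x)) fun m n hmn => ?_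
    obtain ⟨⟨γ, hγ⟩, hγx : γ ((s ^ n) x) = (s ^ m) x⟩ := Quotient.exact hmn
    rw [apply_zpow_of_commute (commute_of_mem_closure hS hγ)] at hγx
    exact (eq_of_zpow_apply_eq_of_not_isWinding hS hx hγ (Subgroup.one_mem _) hγx).symm

variable (s S) in
/-- The joint orbits whose points are winding. -/
def windingOrbits : Set (JointOrbits s S) := jointOrbit s S '' {x | IsWinding s S x}

theorem jointOrbit_mem_windingOrbits (hS : ∀ σ ∈ S, Commute σ s) {x : X} :
    jointOrbit s S x ∈ windingOrbits s S ↔ IsWinding s S x :=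
  ⟨fun ⟨_, hy, hyx⟩ => hy.of_jointOrbit_eq hS hyx.symm, fun hx => ⟨x, hx, rfl⟩⟩

theorem isWinding_out_iff (hS : ∀ σ ∈ S, Commute σ s) {q : JointOrbits s S} :
    IsWinding s S q.out ↔ q ∈ windingOrbits s S := by
  rw [← jointOrbit_mem_windingOrbits hS, jointOrbit, Quotient.out_eq]

end Orbits

section TwistedInvariants

variable {X K : Type*} [Field K] {s : Equiv.Perm X} {S : Set (Equiv.Perm X)} {t : Kˣ}

variable (s S t) in
/-- The functions that are invariant under `S` and are multiplied by `t` under the translation `s`: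
functions on the quotient by `s` with values in a local system of rank one and monodromy `t`. -/
def twistedInvariants : Submodule K (X → K) where
  carrier := {f | (∀ x, f (s x) = t * f x) ∧ ∀ σ ∈ S, ∀ x, f (σ x) = f x}
  zero_mem' := ⟨fun _ => (mul_zero _).symm, fun _ _ _ => rfl⟩
  add_mem' hf hg :=
    ⟨fun x => by simp only [Pi.add_apply, hf.1, hg.1, mul_add],
      fun σ hσ x => by simp only [Pi.add_apply, hf.2 σ hσ, hg.2 σ hσ]⟩
  smul_mem' a f hf :=
    ⟨fun x => by simp only [Pi.smul_apply, smul_eq_mul, hf.1, mul_left_comm],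
      fun σ hσ x => by simp only [Pi.smul_apply, hf.2 σ hσ]⟩

theorem twistedInvariants_anti {S' : Set (Equiv.Perm X)} (h : S ⊆ S') :
    twistedInvariants s S' t ≤ twistedInvariants s S t :=
  fun _ hf => ⟨hf.1, fun σ hσ => hf.2 σ (h hσ)⟩

theorem apply_zpow_of_mem_twistedInvariants {f : X → K} (hf : f ∈ twistedInvariants s S t)
    (n : ℤ) (x : X) : f ((s ^ n) x) = (t ^ n : Kˣ) * f x := by
  have h := apply_zpow_of_semiconj (r := MulAction.toPerm t) hf.1 n x
  rw [h, ← MulAction.toPermHom_apply, ← map_zpow]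
  rfl

theorem apply_of_mem_closure_of_mem_twistedInvariants {f : X → K}
    (hf : f ∈ twistedInvariants s S t) {γ : Equiv.Perm X} (hγ : γ ∈ Subgroup.closure S) (x : X) :
    f (γ x) = f x := by
  induction hγ using Subgroup.closure_induction generalizing x with
  | mem σ hσ => exact hf.2 σ hσ x
  | one => rfl
  | mul γ δ _ _ hγ hδ => rw [Equiv.Perm.mul_apply, hγ, hδ]
  | inv γ _ hγ => rw [← hγ, ← Equiv.Perm.mul_apply, mul_inv_cancel, Equiv.Perm.one_apply]

theorem apply_eq_zero_of_isWinding (ht : ¬ IsOfFinOrder t) {f : X → K}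
    (hf : f ∈ twistedInvariants s S t) {x : X} (hx : IsWinding s S x) : f x = 0 := by
  obtain ⟨k, hk, ⟨γ, hγ⟩, hkx : γ x = (s ^ k) x⟩ := hx
  have htk : ((t ^ k : Kˣ) : K) ≠ 1 := fun h =>
    hk (injective_zpow_iff_not_isOfFinOrder.2 ht (Units.ext (by simpa using h)))
  have hfx : f x = (t ^ k : Kˣ) * f x := by
    rw [← apply_zpow_of_mem_twistedInvariants hf, ← hkx,
      apply_of_mem_closure_of_mem_twistedInvariants hf hγ]
  by_contra hne
  exact htk (mul_right_cancel₀ hne (hfx.symm.trans (one_mul _).symm))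

theorem exists_level_of_not_isWinding (hS : ∀ σ ∈ S, Commute σ s) :
    ∃ m : X → ℤ, ∀ x, ¬ IsWinding s S x →
      ∀ n : ℤ, ∀ δ ∈ Subgroup.closure S, m ((s ^ n) (δ x)) = n + m x := by
  choose m γ hγ hm using exists_eq_zpow_apply_out hS
  refine ⟨m, fun x hx n δ hδ => ?_⟩
  set y := (s ^ n) (δ x) with hy
  have hyx : jointOrbit s S y = jointOrbit s S x := (jointOrbit_eq_iff hS).2 ⟨n, δ, hδ, rfl⟩
  have hout : ¬ IsWinding s S (jointOrbit s S x).out := fun h =>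
    hx (h.of_jointOrbit_eq hS (Quotient.out_eq (jointOrbit s S x)).symm)
  refine eq_of_zpow_apply_eq_of_not_isWinding hS hout (hγ y) (Subgroup.mul_mem _ hδ (hγ x)) ?_
  calc (s ^ m y) (γ y (jointOrbit s S x).out)
      = y := by rw [← hyx, ← hm y]
    _ = (s ^ n) (δ ((s ^ m x) (γ x (jointOrbit s S x).out))) := by rw [hy, ← hm x]
    _ = (s ^ (n + m x)) ((δ * γ x) (jointOrbit s S x).out) := by
      rw [apply_zpow_of_commute (commute_of_mem_closure hS hδ), zpow_apply_zpow_apply,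
        Equiv.Perm.mul_apply]

theorem exists_twistedInvariant_apply_out_eq (hS : ∀ σ ∈ S, Commute σ s)
    (v : ↥(windingOrbits s S)ᶜ → K) :
    ∃ f ∈ twistedInvariants s S t, ∀ q : ↥(windingOrbits s S)ᶜ, f q.1.out = v q := by
  classical
  obtain ⟨m, hm⟩ := exists_level_of_not_isWinding hS
  let v' : JointOrbits s S → K := Function.extend Subtype.val v 0
  let f : X → K := fun x =>
    (t ^ (m x - m (jointOrbit s S x).out) : Kˣ) * v' (jointOrbit s S x)
  have hf : ∀ (n : ℤ), ∀ δ ∈ Subgroup.closure S, ∀ x,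
      f ((s ^ n) (δ x)) = (t ^ n : Kˣ) * f x := by
    intro n δ hδ x
    have hyx : jointOrbit s S ((s ^ n) (δ x)) = jointOrbit s S x :=
      (jointOrbit_eq_iff hS).2 ⟨n, δ, hδ, rfl⟩
    by_cases hx : IsWinding s S x
    · have hv' : v' (jointOrbit s S x) = 0 := by
        refine Function.extend_apply' v (0 : JointOrbits s S → K) _ ?_
        rintro ⟨q, hq : q.1 = _⟩
        exact q.2 (hq ▸ (jointOrbit_mem_windingOrbits hS).2 hx)
      simp only [f, hyx, hv', mul_zero]
    · simp only [f, hyx, hm x hx n δ hδ, add_sub_assoc, zpow_add, Units.val_mul, mul_assoc]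
  refine ⟨f, ⟨fun x => ?_, fun σ hσ x => ?_⟩, fun q => ?_⟩
  · simpa using hf 1 1 (Subgroup.one_mem _) x
  · simpa using hf 0 σ (Subgroup.subset_closure hσ) x
  · have hq : jointOrbit s S q.1.out = q.1 := Quotient.out_eq q.1
    simp only [f, hq, sub_self, zpow_zero, Units.val_one, one_mul]
    exact Subtype.val_injective.extend_apply v 0 q

/-- A twisted invariant is determined by its values on representatives of the joint orbits that do
not wind, and these values are arbitrary. -/
noncomputable def twistedInvariantsEquiv (hS : ∀ σ ∈ S, Commute σ s) (ht : ¬ IsOfFinOrder t) :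
    twistedInvariants s S t ≃ₗ[K] (↥(windingOrbits s S)ᶜ → K) :=
  LinearEquiv.ofBijective
    (LinearMap.funLeft K K (fun q : ↥(windingOrbits s S)ᶜ => q.1.out) ∘ₗ
      (twistedInvariants s S t).subtype) <| by
    refine ⟨(injective_iff_map_eq_zero _).2 fun f hf => Subtype.ext (funext fun x => ?_),
      fun v => ?_⟩
    · by_cases hx : IsWinding s S x
      · exact apply_eq_zero_of_isWinding ht f.2 hx
      · obtain ⟨m, γ, hγ, hxm⟩ := exists_eq_zpow_apply_out hS x
        have hout : f.1 (jointOrbit s S x).out = 0 :=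
          congrFun hf ⟨_, mt (jointOrbit_mem_windingOrbits hS).1 hx⟩
        rw [hxm, apply_zpow_of_mem_twistedInvariants f.2,
          apply_of_mem_closure_of_mem_twistedInvariants f.2 hγ, hout, mul_zero]
        rfl
    · obtain ⟨f, hf, hfv⟩ := exists_twistedInvariant_apply_out_eq (t := t) hS v
      exact ⟨⟨f, hf⟩, funext hfv⟩

theorem finiteDimensional_twistedInvariants [Finite (JointOrbits s S)]
    (hS : ∀ σ ∈ S, Commute σ s) (ht : ¬ IsOfFinOrder t) :
    FiniteDimensional K (twistedInvariants s S t) :=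
  Module.Finite.equiv (twistedInvariantsEquiv hS ht).symm

theorem finrank_twistedInvariants_add_ncard_windingOrbits [Finite (JointOrbits s S)]
    (hS : ∀ σ ∈ S, Commute σ s) (ht : ¬ IsOfFinOrder t) :
    Module.finrank K (twistedInvariants s S t) + (windingOrbits s S).ncard =
      Nat.card (JointOrbits s S) := by
  have := Fintype.ofFinite ↥(windingOrbits s S)ᶜ
  rw [(twistedInvariantsEquiv hS ht).finrank_eq, Module.finrank_pi, ← Nat.card_eq_fintype_card,
    Nat.card_coe_set_eq, add_comm, Set.ncard_add_ncard_compl]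

theorem exists_twistedInvariant_ne_zero_iff (hS : ∀ σ ∈ S, Commute σ s)
    (ht : ¬ IsOfFinOrder t) :
    (∃ f ∈ twistedInvariants s S t, f ≠ 0) ↔ ∃ x, ¬ IsWinding s S x := by
  constructor
  · rintro ⟨f, hf, hne⟩
    obtain ⟨x, hx⟩ := Function.ne_iff.1 hne
    exact ⟨x, fun hw => hx (apply_eq_zero_of_isWinding ht hf hw)⟩
  · rintro ⟨x, hx⟩
    have hmem : jointOrbit s S x ∈ (windingOrbits s S)ᶜ :=
      mt (jointOrbit_mem_windingOrbits hS).1 hx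
    obtain ⟨f, hf, hf1⟩ := exists_twistedInvariant_apply_out_eq (t := t) hS (fun _ => 1)
    exact ⟨f, hf, fun h => one_ne_zero ((hf1 ⟨_, hmem⟩).symm.trans (congrFun h _))⟩

theorem mul_invariant_of_mem_twistedInvariants {S' : Set (Equiv.Perm X)} {f g : X → K}
    (hf : f ∈ twistedInvariants s S t) (hg : g ∈ twistedInvariants s S' t⁻¹) (x : X) :
    f (s x) * g (s x) = f x * g x := by
  rw [hf.1, hg.1, mul_mul_mul_comm, Units.mul_inv, one_mul]

end TwistedInvariants

section OrbitSum

variable {X K : Type*} {s : Equiv.Perm X}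

theorem apply_out_eq_of_invariant {h : X → K} (hs : ∀ x, h (s x) = h x) (x : X) :
    h (Quotient.mk (Equiv.Perm.SameCycle.setoid s) x).out = h x := by
  obtain ⟨n, hn⟩ := Quotient.mk_out (s := Equiv.Perm.SameCycle.setoid s) x
  have h1 := apply_zpow_of_semiconj (r := 1) hs n
    (Quotient.mk (Equiv.Perm.SameCycle.setoid s) x).out
  rwa [hn, one_zpow, Equiv.Perm.one_apply, eq_comm] at h1

variable [Field K] {t : Kˣ}

variable (K s) in
/-- Restriction of functions to representatives of the orbits of `s`. -/
noncomputable def restrictOut :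
    (X → K) →ₗ[K] (Quotient (Equiv.Perm.SameCycle.setoid s) → K) :=
  LinearMap.funLeft K K Quotient.out

theorem restrictOut_injective {U : Submodule K (X → K)} (hU : U ≤ twistedInvariants s ∅ t) :
    Function.Injective ((restrictOut K s).domRestrict U) := by
  refine (injective_iff_map_eq_zero _).2 fun f hf => Subtype.ext (funext fun x => ?_)
  obtain ⟨n, hn⟩ := Quotient.mk_out (s := Equiv.Perm.SameCycle.setoid s) x
  rw [← hn, apply_zpow_of_mem_twistedInvariants (hU f.2)]
  exact mul_eq_zero_of_right _ (congrFun hf _)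

theorem finrank_map_restrictOut {U : Submodule K (X → K)} (hU : U ≤ twistedInvariants s ∅ t) :
    Module.finrank K (U.map (restrictOut K s)) = Module.finrank K U := by
  rw [← LinearMap.range_domRestrict, LinearMap.finrank_range_of_inj (restrictOut_injective hU)]

variable [Fintype (Quotient (Equiv.Perm.SameCycle.setoid s))]

variable (s) in
/-- The sum of the values of `h` at representatives of the orbits of `s`, used for functions `h`
that are invariant under `s`. -/
noncomputable def orbitSum (h : X → K) : K :=
  ∑ q : Quotient (Equiv.Perm.SameCycle.setoid s), h q.out

theorem orbitSum_comp {σ : Equiv.Perm X} (hσ : Commute σ s) {h : X → K}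
    (hs : ∀ x, h (s x) = h x) : orbitSum s (fun x => h (σ x)) = orbitSum s h := by
  have hcycle : ∀ x y, s.SameCycle x y ↔ s.SameCycle (σ x) (σ y) := fun x y =>
    exists_congr fun n => by rw [← apply_zpow_of_commute hσ, σ.injective.eq_iff]
  refine Fintype.sum_equiv (Quotient.congr σ hcycle) _ _ fun q => ?_
  conv_rhs => rw [← Quotient.out_eq q]
  exact (apply_out_eq_of_invariant hs (σ q.out)).symm

/-- The sum cancels in pairs `x`, `σ x`. -/
theorem orbitSum_eq_zero_of_involution [CharP K 2] {σ : Equiv.Perm X} (hσ : Commute σ s)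
    (hinv : ∀ x, σ (σ x) = x) (hne : ∀ x, ¬ s.SameCycle x (σ x)) {h : X → K}
    (hs : ∀ x, h (s x) = h x) (hhσ : ∀ x, h (σ x) = h x) : orbitSum s h = 0 := by
  let τ : Quotient (Equiv.Perm.SameCycle.setoid s) → Quotient (Equiv.Perm.SameCycle.setoid s) :=
    Quotient.map σ fun x y ⟨n, hn⟩ => ⟨n, by rw [← apply_zpow_of_commute hσ, hn]⟩
  refine Finset.sum_involution (fun q _ => τ q) (fun q _ => ?_) (fun q _ _ => ?_)
    (fun _ _ => Finset.mem_univ _) (fun q _ => ?_)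
  · induction q using Quotient.inductionOn with | h x =>
    change _ + h (Quotient.mk (Equiv.Perm.SameCycle.setoid s) (σ x)).out = 0
    rw [apply_out_eq_of_invariant hs, apply_out_eq_of_invariant hs, hhσ,
      CharTwo.add_self_eq_zero]
  · induction q using Quotient.inductionOn with | h x =>
    exact fun h => hne x (Equiv.Perm.SameCycle.symm (Quotient.exact h))
  · induction q using Quotient.inductionOn with | h x =>
    exact congrArg _ (hinv x)

theorem orbitSum_add_apply_mul_eq_zero [CharP K 2] {σ : Equiv.Perm X} (hσ : Commute σ s)
    {g w : X → K} (hg : g ∈ twistedInvariants s ∅ t) (hw : w ∈ twistedInvariants s {σ} t⁻¹) :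
    orbitSum s (fun x => (g x + g (σ x)) * w x) = 0 := by
  have hσw : orbitSum s (fun x => g (σ x) * w x) = orbitSum s fun x => g x * w x := by
    rw [← orbitSum_comp (h := fun x => g x * w x) hσ
      (mul_invariant_of_mem_twistedInvariants hg hw)]
    simp only [hw.2 σ rfl]
  have hsum : orbitSum s (fun x => (g x + g (σ x)) * w x) =
      orbitSum s (fun x => g x * w x) + orbitSum s fun x => g (σ x) * w x := by
    simp only [orbitSum, add_mul, Finset.sum_add_distrib]
  rw [hsum, hσw, CharTwo.add_self_eq_zero]

theorem finrank_add_finrank_le_of_orthogonal {U N : Submodule K (X → K)}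
    (hU : U ≤ twistedInvariants s ∅ t⁻¹) (hN : N ≤ twistedInvariants s ∅ t)
    (h : ∀ f ∈ N, ∀ g ∈ U, orbitSum s (fun x => f x * g x) = 0) :
    Module.finrank K N + Module.finrank K U ≤
      Fintype.card (Quotient (Equiv.Perm.SameCycle.setoid s)) := by
  classical
  let Φ := (dotProductEquiv K (Quotient (Equiv.Perm.SameCycle.setoid s))).toLinearMap
  have hperp : (N.map (restrictOut K s)).map Φ ≤ (U.map (restrictOut K s)).dualAnnihilator := by
    rintro _ ⟨_, ⟨f, hf, rfl⟩, rfl⟩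
    rw [Submodule.mem_dualAnnihilator]
    rintro _ ⟨g, hg, rfl⟩
    exact h f hf g hg
  have hle := Submodule.finrank_mono hperp
  have hann := Subspace.finrank_add_finrank_dualAnnihilator_eq (U.map (restrictOut K s))
  rw [LinearEquiv.finrank_map_eq (dotProductEquiv K _), finrank_map_restrictOut hN] at hle
  rw [finrank_map_restrictOut hU, Module.finrank_pi] at hann
  omega

end OrbitSum

section GenericUnit

open LaurentPolynomial

theorem eval₂_mapRingHom {R S A : Type*} [CommRing R] [CommRing S] [CommRing A] (φ : R →+* S)
    (ψ : S →+* A) (t : Aˣ) (P : R[T;T⁻¹]) :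
    eval₂ ψ t (AddMonoidAlgebra.mapRingHom ℤ φ P) = eval₂ (ψ.comp φ) t P := by
  induction P using LaurentPolynomial.induction_on' with
  | add p q hp hq => simp only [map_add, hp, hq]
  | C_mul_T n a =>
    rw [← single_eq_C_mul_T, AddMonoidAlgebra.mapRingHom_single, single_eq_C_mul_T,
      single_eq_C_mul_T, eval₂_C_mul_T, eval₂_C_mul_T, RingHom.comp_apply]

theorem not_isOfFinOrder_of_injective_eval₂ {R A : Type*} [CommRing R] [Nontrivial R] [CommRing A]
    {ψ : R →+* A} {t : Aˣ} (h : Function.Injective (eval₂ ψ t)) : ¬ IsOfFinOrder t := by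
  rw [← injective_zpow_iff_not_isOfFinOrder]
  intro m n hmn
  have hT : (T m : R[T;T⁻¹]) = T n := h (by rw [eval₂_T, eval₂_T]; exact congrArg Units.val hmn)
  exact WithBot.coe_injective (by rw [← degree_T (R := R) m, hT, degree_T])

theorem exists_unit_injective_eval₂ (R : Type*) [CommRing R] [IsDomain R] :
    ∃ t : (FractionRing R[T;T⁻¹])ˣ,
      Function.Injective (eval₂ (algebraMap R (FractionRing R[T;T⁻¹])) t) := by
  let ι := algebraMap R[T;T⁻¹] (FractionRing R[T;T⁻¹])
  let φ : Multiplicative ℤ →* FractionRing R[T;T⁻¹] :=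
    ι.toMonoidHom.comp (AddMonoidAlgebra.of R ℤ)
  let t := Units.map φ (toUnits (Multiplicative.ofAdd 1))
  have ht : ∀ n : ℤ, ((t ^ n : (FractionRing R[T;T⁻¹])ˣ) : FractionRing R[T;T⁻¹]) = ι (T n) :=
    fun n => by
      rw [← map_zpow, ← map_zpow, ← ofAdd_zsmul, smul_eq_mul, mul_one]
      rfl
  have heval : ∀ P, eval₂ (algebraMap R (FractionRing R[T;T⁻¹])) t P = ι P := by
    intro P
    induction P using LaurentPolynomial.induction_on' with
    | add p q hp hq => simp only [map_add, hp, hq]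
    | C_mul_T n a =>
      rw [eval₂_C_mul_T, ht, map_mul, C_eq_algebraMap, ← IsScalarTower.algebraMap_apply]
  refine ⟨t, fun P Q h => IsFractionRing.injective R[T;T⁻¹] (FractionRing R[T;T⁻¹]) ?_⟩
  rwa [heval, heval] at h

end GenericUnit

namespace LinkDiagram

variable {H : Type*} (L : LinkDiagram H)

/-- The two moves that continue a component from a half-edge: along its edge, and straight through
its crossing. -/
abbrev strandMoves : Set (Equiv.Perm H) := {L.mate, L.next * L.next}

theorem component_mate (h : H) : L.component (L.mate h) = L.component h :=
  (Quot.sound (Or.inl rfl) : L.component h = _).symm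

theorem component_next_next (h : H) : L.component (L.next (L.next h)) = L.component h :=
  (Quot.sound (Or.inr rfl) : L.component h = _).symm

theorem next_mul_next_mul_mate_mem_closure :
    L.next * L.next * L.mate ∈ Subgroup.closure L.strandMoves :=
  Subgroup.mul_mem _ (Subgroup.subset_closure (Or.inr rfl)) (Subgroup.subset_closure (Or.inl rfl))

theorem iterate_step (n : ℕ) (h : H) : L.step^[n] h = ((L.next * L.next * L.mate) ^ n) h :=
  congrFun (Equiv.Perm.iterate_eq_pow (L.next * L.next * L.mate) n) h

theorem finite_orbit_of_iterate_step_eq {h : H} {k : ℕ} (hk : 0 < k) (hh : L.step^[k] h = h) :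
    (MulAction.orbit (Subgroup.closure L.strandMoves) h).Finite := by
  let Y : Set H := {x | ∃ i, x = L.step^[i] h ∨ x = L.mate (L.step^[i] h)}
  have hmate : ∀ x ∈ Y, L.mate x ∈ Y := by
    rintro x ⟨i, rfl | rfl⟩
    · exact ⟨i, Or.inr rfl⟩
    · exact ⟨i, Or.inl (L.mate_mate _)⟩
  have hnext : ∀ x ∈ Y, L.next (L.next x) ∈ Y := by
    rintro x ⟨i, rfl | rfl⟩
    · refine ⟨i + (k - 1), Or.inr ?_⟩
      have hpred : L.step^[i] h = L.step (L.step^[i + (k - 1)] h) := by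
        rw [← Function.iterate_succ_apply' L.step, Nat.succ_eq_add_one,
          show i + (k - 1) + 1 = i + k by omega, Function.iterate_add_apply, hh]
      rw [hpred, step, L.next_four]
    · exact ⟨i + 1, Or.inl (Function.iterate_succ_apply' L.step i h).symm⟩
  have hYfin : Y.Finite := by
    have hper : Function.IsPeriodicPt L.step k h := hh
    refine (((Set.finite_Iio k).image fun i => L.step^[i] h).union
      ((Set.finite_Iio k).image fun i => L.mate (L.step^[i] h))).subset ?_
    rintro x ⟨i, hi⟩
    rw [← hper.iterate_mod_apply i] at hi
    exact hi.imp (fun hi => ⟨i % k, Nat.mod_lt _ hk, hi.symm⟩)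
      fun hi => ⟨i % k, Nat.mod_lt _ hk, hi.symm⟩
  refine hYfin.subset (orbit_closure_subset ?_ ⟨0, Or.inl rfl⟩)
  rintro _ (rfl | rfl) x
  · exact ⟨fun hx => by simpa only [L.mate_mate] using hmate _ hx, hmate x⟩
  · exact ⟨fun hx => by simpa only [Equiv.Perm.mul_apply, L.next_four] using hnext _ hx, hnext x⟩

theorem exists_isClosed_iff_exists_not_isWinding {s : Equiv.Perm H}
    [Finite (Quotient (Equiv.Perm.SameCycle.setoid s))]
    (hs : ∀ σ ∈ L.strandMoves, Commute σ s) (hfree : ∀ (n : ℤ) h, (s ^ n) h = h → n = 0) :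
    (∃ K : L.Component, K.IsClosed) ↔ ∃ h, ¬ IsWinding s L.strandMoves h := by
  constructor
  · rintro ⟨-, h, rfl, k, hk, hh⟩
    exact ⟨h, fun hw => hw.infinite_orbit hs (fun n => hfree n h)
      (L.finite_orbit_of_iterate_step_eq hk hh)⟩
  · rintro ⟨h, hw⟩
    let σ : Equiv.Perm H := L.next * L.next * L.mate
    have hσ : ∀ n : ℕ, σ ^ n ∈ Subgroup.closure L.strandMoves :=
      Subgroup.pow_mem _ L.next_mul_next_mul_mate_mem_closure
    obtain ⟨i, j, hij, hsame⟩ : ∃ i j : ℕ, i < j ∧ s.SameCycle ((σ ^ i) h) ((σ ^ j) h) := by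
      obtain ⟨i, j, hne, hsame⟩ := Finite.exists_ne_map_eq_of_infinite fun n : ℕ =>
        (Quotient.mk (Equiv.Perm.SameCycle.setoid s) ((σ ^ n) h))
      rcases hne.lt_or_gt with hij | hij
      · exact ⟨i, j, hij, Quotient.exact hsame⟩
      · exact ⟨j, i, hij, Quotient.exact hsame.symm⟩
    obtain ⟨n, hn⟩ := hsame
    obtain rfl : n = 0 := eq_of_zpow_apply_eq_of_not_isWinding hs hw (hσ i) (hσ j) (n := 0) hn
    refine ⟨L.component h, h, rfl, j - i, Nat.sub_pos_of_lt hij, (σ ^ i).injective ?_⟩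
    rw [iterate_step, ← Equiv.Perm.mul_apply, ← pow_add, Nat.add_sub_cancel' hij.le]
    exact hn.symm

/-- The components of the link as the orbits of the two moves. -/
def componentEquiv :
    L.Component ≃ MulAction.orbitRel.Quotient (Subgroup.closure L.strandMoves) H where
  toFun := Quot.lift (Quotient.mk _) <| by
    rintro h _ (rfl | rfl)
    · exact Quotient.sound <| (MulAction.orbitRel _ _).symm
        ⟨⟨L.mate, Subgroup.subset_closure (Or.inl rfl)⟩, rfl⟩
    · exact Quotient.sound <| (MulAction.orbitRel _ _).symm
        ⟨⟨L.next * L.next, Subgroup.subset_closure (Or.inr rfl)⟩, rfl⟩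
  invFun := Quotient.lift L.component <| by
    intro x y hxy
    refine orbit_closure_subset (Y := {x | L.component x = L.component y}) ?_ rfl hxy
    rintro _ (rfl | rfl) z
    · exact Eq.congr_left (L.component_mate z)
    · exact Eq.congr_left (L.component_next_next z)
  left_inv := by rintro ⟨h⟩; rfl
  right_inv := by rintro ⟨h⟩; rfl

section Colorings

variable {A : Type*} [AddCommGroup A] [Module (ZMod 2) A]

theorem coloring_next_next (c : L.colorings A) (h : H) :
    c.1 (L.arc (L.next (L.next h))) = c.1 (L.arc h) := by
  by_cases ho : L.isOver h
  · exact (congrArg c.1 (Quot.sound (Or.inr ⟨ho, rfl⟩) : L.arc h = _)).symm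
  · have hcross := c.2 _ ((L.isOver_next h).2 ho)
    rw [two_smul, ZModModule.add_self, Equiv.symm_apply_apply, eq_comm, ← ZModModule.sub_eq_add,
      sub_eq_zero] at hcross
    exact hcross

/-- In 2-torsion groups, the colorings are the functions on the components of the link. -/
def coloringsEquiv : L.colorings A ≃ (L.Component → A) where
  toFun c := Quot.lift (fun h => c.1 (L.arc h)) <| by
    rintro h _ (rfl | rfl)
    · exact congrArg c.1 (Quot.sound (Or.inl rfl) : L.arc h = _)
    · exact (L.coloring_next_next c h).symm
  invFun f := ⟨Quot.lift (fun h => f (L.component h)) <| by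
    rintro h _ (rfl | ⟨-, rfl⟩)
    · exact (congrArg f (L.component_mate h)).symm
    · exact (congrArg f (L.component_next_next h)).symm, by
    intro h _
    have hopp : L.component (L.next h) = L.component (L.next.symm h) := by
      rw [← L.component_next_next (L.next.symm h), Equiv.apply_symm_apply]
    change 2 • f (L.component h) = f (L.component (L.next h)) + f (L.component (L.next.symm h))
    rw [hopp, two_smul, ZModModule.add_self, ZModModule.add_self]⟩
  left_inv c := Subtype.ext (funext (by rintro ⟨h⟩; rfl))
  right_inv f := funext (by rintro ⟨h⟩; rfl)

theorem infinite_colorings_iff [Finite A] [Nontrivial A] :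
    Infinite (L.colorings A) ↔ Infinite L.Component := by
  rw [L.coloringsEquiv.infinite_iff]
  refine ⟨fun hinf => ?_, fun _ => Function.infinite_of_left⟩
  by_contra hfin
  rw [not_infinite_iff_finite] at hfin
  exact not_finite (L.Component → A)

end Colorings

end LinkDiagram

namespace PeriodicGraph

variable {V D : Type*} (G : PeriodicGraph V D)

theorem commute_rev_shiftD : Commute G.rev G.shiftD :=
  Equiv.ext fun d => G.rev_shift d

theorem commute_of_mem_rev : ∀ σ ∈ ({G.rev} : Set (Equiv.Perm D)), Commute σ G.shiftD := by
  rintro _ rfl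
  exact G.commute_rev_shiftD

theorem tail_zpow (n : ℤ) (d : D) : G.tail ((G.shiftD ^ n) d) = (G.shiftV ^ n) (G.tail d) :=
  apply_zpow_of_semiconj G.tail_shift n d

theorem eq_zero_of_shiftD_zpow_eq {n : ℤ} {d : D} (h : (G.shiftD ^ n) d = d) : n = 0 :=
  G.free n _ (by rw [← tail_zpow, h])

theorem shiftD_zpow_ne_rev (n : ℤ) (d : D) : (G.shiftD ^ n) d ≠ G.rev d := by
  intro h
  have hdouble : (G.shiftD ^ (n + n)) d = d := by
    rw [← zpow_apply_zpow_apply, h, ← apply_zpow_of_commute G.commute_rev_shiftD, h, G.rev_rev]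
  have hzero := G.eq_zero_of_shiftD_zpow_eq hdouble
  obtain rfl : n = 0 := by omega
  exact G.rev_ne d h.symm

theorem not_sameCycle_rev (d : D) : ¬ G.shiftD.SameCycle d (G.rev d) :=
  fun ⟨n, hn⟩ => G.shiftD_zpow_ne_rev n d hn

theorem apply_of_mem_closure_rev {γ : Equiv.Perm D} (hγ : γ ∈ Subgroup.closure {G.rev}) (d : D) :
    γ d = d ∨ γ d = G.rev d := by
  obtain ⟨n, rfl⟩ := Subgroup.mem_closure_singleton.1 hγ
  have hsq : G.rev ^ (2 : ℤ) = 1 := Equiv.ext fun d => G.rev_rev d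
  rcases Int.even_or_odd' n with ⟨m, rfl | rfl⟩
  · left; rw [zpow_mul, hsq, one_zpow, Equiv.Perm.one_apply]
  · right; rw [zpow_add_one, zpow_mul, hsq, one_zpow, one_mul]

theorem not_isWinding_rev (d : D) : ¬ IsWinding G.shiftD {G.rev} d := by
  rintro ⟨k, hk, ⟨γ, hγ⟩, hd : γ d = _⟩
  rcases G.apply_of_mem_closure_rev hγ d with h | h
  · exact hk (G.eq_zero_of_shiftD_zpow_eq (hd.symm.trans h))
  · exact G.shiftD_zpow_ne_rev k d (hd.symm.trans h)

theorem card_dartOrbit_le :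
    Nat.card G.DartOrbit ≤ 2 * Nat.card (JointOrbits G.shiftD {G.rev}) := by
  let f : JointOrbits G.shiftD {G.rev} × Bool → G.DartOrbit :=
    fun p => Quotient.mk _ (if p.2 then G.rev p.1.out else p.1.out)
  have hf : Function.Surjective f := by
    rintro ⟨d⟩
    obtain ⟨m, γ, hγ, hd⟩ := exists_eq_zpow_apply_out G.commute_of_mem_rev d
    rcases G.apply_of_mem_closure_rev hγ (jointOrbit G.shiftD {G.rev} d).out with h | h
    · exact ⟨(jointOrbit G.shiftD {G.rev} d, false), Quotient.sound ⟨m, (h ▸ hd).symm⟩⟩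
    · exact ⟨(jointOrbit G.shiftD {G.rev} d, true), Quotient.sound ⟨m, (h ▸ hd).symm⟩⟩
  have hle := Nat.card_le_card_of_surjective f hf
  rwa [Nat.card_prod, Nat.card_eq_fintype_card (α := Bool), Fintype.card_bool, mul_comm] at hle

theorem zpow_level (v : V) : (G.shiftV ^ G.level v) (G.vertexOrbit v).out = v :=
  (G.exists_level v).choose_spec

theorem vertexOrbit_zpow (n : ℤ) (v : V) :
    G.vertexOrbit ((G.shiftV ^ n) v) = G.vertexOrbit v :=
  (Quotient.sound ⟨n, rfl⟩ : G.vertexOrbit v = _).symm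

theorem level_zpow (n : ℤ) (v : V) : G.level ((G.shiftV ^ n) v) = n + G.level v := by
  have h : (G.shiftV ^ G.level ((G.shiftV ^ n) v)) (G.vertexOrbit v).out =
      (G.shiftV ^ (n + G.level v)) (G.vertexOrbit v).out := by
    rw [← zpow_apply_zpow_apply, zpow_level, ← G.vertexOrbit_zpow n v, zpow_level]
  refine sub_eq_zero.1 (G.free _ (G.vertexOrbit v).out ?_)
  rw [sub_eq_neg_add, ← zpow_apply_zpow_apply, h, zpow_apply_zpow_apply, neg_add_cancel, zpow_zero,
    Equiv.Perm.one_apply]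

/-- The function on darts, depending only on the tail of a dart, that takes the value `a i` at the
chosen vertex `v_{i,0}` of every orbit `i` and is multiplied by `t` under the translation. -/
noncomputable def vertexFunction {K : Type*} [Field K] (t : Kˣ) :
    (G.VertexOrbit → K) →ₗ[K] (D → K) where
  toFun a d := (t ^ G.level (G.tail d) : Kˣ) * a (G.vertexOrbit (G.tail d))
  map_add' _ _ := funext fun _ => mul_add _ _ _
  map_smul' _ _ := funext fun _ => mul_left_comm _ _ _

theorem vertexFunction_injective {K : Type*} [Field K] (t : Kˣ) :
    Function.Injective (G.vertexFunction t) := by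
  refine (injective_iff_map_eq_zero _).2 fun a ha => funext fun i => ?_
  obtain ⟨d, hd⟩ := G.no_isolated i.out
  have hi : G.vertexOrbit (G.tail d) = i := by rw [hd]; exact Quotient.out_eq i
  have hzero := congrFun ha d
  exact hi ▸ (mul_eq_zero.1 hzero).resolve_left (Units.ne_zero _)

end PeriodicGraph

namespace PlanePeriodicGraph

section Faces

variable {V D : Type*} (G : PlanePeriodicGraph V D)

theorem commute_rot_shiftD : Commute G.rot G.shiftD :=
  Equiv.ext fun d => G.rot_shift d

theorem commute_face_shiftD : Commute (G.rot * G.rev) G.shiftD :=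
  G.commute_rot_shiftD.mul_left G.commute_rev_shiftD

theorem commute_of_mem_rot : ∀ σ ∈ ({G.rot} : Set (Equiv.Perm D)), Commute σ G.shiftD := by
  rintro _ rfl
  exact G.commute_rot_shiftD

theorem commute_of_mem_face :
    ∀ σ ∈ ({G.rot * G.rev} : Set (Equiv.Perm D)), Commute σ G.shiftD := by
  rintro _ rfl
  exact G.commute_face_shiftD

theorem commute_of_mem_rot_rev :
    ∀ σ ∈ ({G.rot, G.rev} : Set (Equiv.Perm D)), Commute σ G.shiftD := by
  rintro _ (rfl | rfl)
  · exact G.commute_rot_shiftD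
  · exact G.commute_rev_shiftD

theorem closure_face_le : Subgroup.closure {G.rot * G.rev} ≤ Subgroup.closure {G.rot, G.rev} := by
  rw [Subgroup.closure_le, Set.singleton_subset_iff]
  exact Subgroup.mul_mem _ (Subgroup.subset_closure (by simp)) (Subgroup.subset_closure (by simp))

/-- The boundary walk through `d` climbs by one period. -/
def IsUpward (d : D) : Prop := ∃ k : ℕ, 0 < k ∧ ((G.rot * G.rev) ^ k) d = G.shiftD d

/-- The boundary walk through `d` descends by one period. -/
def IsDownward (d : D) : Prop := ∃ k : ℕ, 0 < k ∧ ((G.rot * G.rev) ^ k) d = G.shiftD.symm d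

variable {G}

theorem IsUpward.zpow {d : D} (n : ℤ) : G.IsUpward d → G.IsUpward ((G.shiftD ^ n) d) := by
  rintro ⟨k, hk, h⟩
  refine ⟨k, hk, ?_⟩
  rw [apply_zpow_of_commute (G.commute_face_shiftD.pow_left k), h,
    apply_zpow_of_commute (Commute.refl _)]

theorem IsDownward.zpow {d : D} (n : ℤ) : G.IsDownward d → G.IsDownward ((G.shiftD ^ n) d) := by
  rintro ⟨k, hk, h⟩
  refine ⟨k, hk, ?_⟩
  rw [apply_zpow_of_commute (G.commute_face_shiftD.pow_left k), h]
  exact (apply_zpow_of_commute (Commute.refl G.shiftD).inv_left n d).symm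

theorem not_isWinding_of_pow_face_eq {d : D} {k : ℕ} (hk : 0 < k)
    (h : ((G.rot * G.rev) ^ k) d = d) : ¬ IsWinding G.shiftD {G.rot * G.rev} d := by
  rintro ⟨m, hm, hd⟩
  obtain ⟨j, hj⟩ := mem_orbit_closure_singleton.1 hd
  have hmul := zpow_mul_apply_of_commute (G.commute_face_shiftD.zpow_left j) hj.symm k
  have hfix : (((G.rot * G.rev) ^ k) ^ j) d = d := Function.IsFixedPt.perm_zpow h j
  rw [zpow_comm, zpow_natCast _ k, hfix] at hmul
  rcases mul_eq_zero.1 (G.eq_zero_of_shiftD_zpow_eq hmul) with hzero | hzero <;> omega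

theorem isUpward_or_isDownward {d : D} (hd : IsWinding G.shiftD {G.rot * G.rev} d) :
    G.IsUpward d ∨ G.IsDownward d := by
  obtain ⟨k, hk, h | h | h⟩ := G.winding d
  · exact absurd hd (not_isWinding_of_pow_face_eq hk h)
  · exact Or.inl ⟨k, hk, h⟩
  · exact Or.inr ⟨k, hk, h⟩

theorem face_eq_of_component_eq {p : D → Prop} (hp : ∀ d (n : ℤ), p d → p ((G.shiftD ^ n) d))
    (huniq : ∀ d e, d ∈ MulAction.orbit (Subgroup.closure {G.rot, G.rev}) e → p d → p e →
      (G.rot * G.rev).SameCycle d e) {d e : D}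
    (hde : jointOrbit G.shiftD {G.rot, G.rev} d = jointOrbit G.shiftD {G.rot, G.rev} e)
    (hd : p d) (he : p e) :
    jointOrbit G.shiftD {G.rot * G.rev} d = jointOrbit G.shiftD {G.rot * G.rev} e := by
  obtain ⟨m, γ, hγ, rfl⟩ := (jointOrbit_eq_iff G.commute_of_mem_rot_rev).1 hde
  rw [← apply_zpow_of_commute (commute_of_mem_closure G.commute_of_mem_rot_rev hγ)] at hd ⊢
  obtain ⟨j, hj⟩ := huniq (γ ((G.shiftD ^ m) e)) _ ⟨⟨γ, hγ⟩, rfl⟩ hd (hp _ m he)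
  refine ((jointOrbit_eq_iff G.commute_of_mem_face).2
    ⟨-m, (G.rot * G.rev) ^ j, Subgroup.mem_closure_singleton.2 ⟨j, rfl⟩, ?_⟩).symm
  rw [hj, zpow_apply_zpow_apply, neg_add_cancel, zpow_zero, Equiv.Perm.one_apply]

/-- A component has at most one upward and at most one downward face. -/
theorem ncard_windingOrbits_face_le (G : PlanePeriodicGraph V D) :
    (windingOrbits G.shiftD {G.rot * G.rev}).ncard ≤
      2 * (windingOrbits G.shiftD {G.rot, G.rev}).ncard := by
  classical
  have hS := G.commute_of_mem_face
  let f : windingOrbits G.shiftD {G.rot * G.rev} →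
      windingOrbits G.shiftD {G.rot, G.rev} × Bool :=
    fun q => (⟨_, (jointOrbit_mem_windingOrbits G.commute_of_mem_rot_rev).2
      (((isWinding_out_iff hS).2 q.2).mono G.closure_face_le)⟩, decide (G.IsUpward q.1.out))
  have hf : Function.Injective f := by
    rintro ⟨q, hq⟩ ⟨r, hr⟩ h
    have hcomp : jointOrbit G.shiftD {G.rot, G.rev} q.out =
        jointOrbit G.shiftD {G.rot, G.rev} r.out := congrArg (fun z => z.1.1) h
    have hup : G.IsUpward q.out ↔ G.IsUpward r.out := decide_eq_decide.1 (congrArg Prod.snd h)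
    rw [Subtype.mk.injEq, ← Quotient.out_eq q, ← Quotient.out_eq r]
    by_cases hu : G.IsUpward q.out
    · exact face_eq_of_component_eq (fun _ n => IsUpward.zpow n) G.upward_unique hcomp hu (hup.1 hu)
    · exact face_eq_of_component_eq (fun _ n => IsDownward.zpow n) G.downward_unique hcomp
        ((isUpward_or_isDownward ((isWinding_out_iff hS).2 hq)).resolve_left hu)
        ((isUpward_or_isDownward ((isWinding_out_iff hS).2 hr)).resolve_left (mt hup.2 hu))
  have hle := Nat.card_le_card_of_injective f hf
  rwa [Nat.card_prod, Nat.card_eq_fintype_card (α := Bool), Fintype.card_bool, mul_comm,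
    Nat.card_coe_set_eq, Nat.card_coe_set_eq] at hle

end Faces

end PlanePeriodicGraph

namespace PeriodicGraph

variable {V D K : Type*} (G : PeriodicGraph V D) [Field K] {t : Kˣ}

variable (t) in
/-- The functions on the edges of the quotient graph with values in the local system of
monodromy `t`, as functions on darts. -/
abbrev edgeFunctions : Submodule K (D → K) := twistedInvariants G.shiftD {G.rev} t

theorem finrank_edgeFunctions (ht : ¬ IsOfFinOrder t) :
    Module.finrank K (G.edgeFunctions t) = Nat.card (JointOrbits G.shiftD {G.rev}) := by
  have hempty : windingOrbits G.shiftD {G.rev} = ∅ :=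
    Set.image_eq_empty.2 (Set.eq_empty_iff_forall_notMem.2 G.not_isWinding_rev)
  rw [← finrank_twistedInvariants_add_ncard_windingOrbits G.commute_of_mem_rev ht, hempty,
    Set.ncard_empty, add_zero]

variable (K) in
/-- The difference of the values of a function at the two darts of an edge; as it is only used in
characteristic two, it is written as a sum. -/
def coboundary : (D → K) →ₗ[K] (D → K) := LinearMap.id + LinearMap.funLeft K K G.rev

theorem coboundary_apply (f : D → K) (d : D) : G.coboundary K f d = f d + f (G.rev d) := rfl

theorem coboundary_mem_edgeFunctions {f : D → K} (hf : f ∈ twistedInvariants G.shiftD ∅ t) :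
    G.coboundary K f ∈ G.edgeFunctions t := by
  refine ⟨fun d => ?_, ?_⟩
  · rw [coboundary_apply, coboundary_apply, G.rev_shift, hf.1, hf.1, mul_add]
  · rintro _ rfl d
    rw [coboundary_apply, coboundary_apply, G.rev_rev, add_comm]

theorem coboundary_eq_zero_iff [CharP K 2] {f : D → K} :
    G.coboundary K f = 0 ↔ ∀ d, f (G.rev d) = f d := by
  simp only [funext_iff, coboundary_apply, Pi.zero_apply, CharTwo.add_eq_zero]
  exact forall_congr' fun d => eq_comm

theorem orbitSum_edgeFunction_mul_eq_zero [CharP K 2] {f g : D → K}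
    (hf : f ∈ G.edgeFunctions t) (hg : g ∈ G.edgeFunctions t⁻¹) :
    orbitSum G.shiftD (fun d => f d * g d) = 0 :=
  orbitSum_eq_zero_of_involution (h := fun d => f d * g d) G.commute_rev_shiftD G.rev_rev
    G.not_sameCycle_rev (mul_invariant_of_mem_twistedInvariants hf hg)
    fun d => by rw [hf.2 _ rfl, hg.2 _ rfl]

end PeriodicGraph

namespace PlanePeriodicGraph

section Functions

variable {V D K : Type*} (G : PlanePeriodicGraph V D) [Field K] {t : Kˣ}

variable (t) in
/-- The functions on the vertices of the quotient graph with values in the local system of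
monodromy `t`, as functions on darts. -/
abbrev vertexFunctions : Submodule K (D → K) := twistedInvariants G.shiftD {G.rot} t

variable (t) in
/-- The functions on the faces of the quotient graph with values in the local system of
monodromy `t`, as functions on darts. -/
abbrev faceFunctions : Submodule K (D → K) := twistedInvariants G.shiftD {G.rot * G.rev} t

variable (t) in
/-- The functions on the connected components of the quotient graph with values in the local system
of monodromy `t`, as functions on darts. -/
abbrev componentFunctions : Submodule K (D → K) := twistedInvariants G.shiftD {G.rot, G.rev} t

theorem range_vertexFunction : LinearMap.range (G.vertexFunction t) = G.vertexFunctions t := by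
  ext f
  constructor
  · rintro ⟨a, rfl⟩
    refine ⟨fun d => ?_, ?_⟩
    · have hlevel := G.level_zpow 1 (G.tail d)
      have horbit := G.vertexOrbit_zpow 1 (G.tail d)
      rw [zpow_one] at hlevel horbit
      simp only [PeriodicGraph.vertexFunction, LinearMap.coe_mk, AddHom.coe_mk, G.tail_shift,
        hlevel, horbit, zpow_one_add, Units.val_mul, mul_assoc]
    · rintro _ rfl d
      have htail : G.tail (G.rot d) = G.tail d := (G.tail_eq_iff _ _).2 ⟨-1, by simp⟩
      simp only [PeriodicGraph.vertexFunction, LinearMap.coe_mk, AddHom.coe_mk, htail]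
  · intro hf
    choose e he using fun i : G.VertexOrbit => G.no_isolated i.out
    refine ⟨fun i => f (e i), funext fun d => ?_⟩
    have htail : G.tail ((G.shiftD ^ G.level (G.tail d)) (e (G.vertexOrbit (G.tail d)))) =
        G.tail d := by rw [G.tail_zpow, he, G.zpow_level]
    obtain ⟨j, hj⟩ := (G.tail_eq_iff _ _).1 htail
    rw [← hj, apply_of_mem_closure_of_mem_twistedInvariants hf
      (Subgroup.mem_closure_singleton.2 ⟨j, rfl⟩), apply_zpow_of_mem_twistedInvariants hf, hj]
    rfl

theorem finrank_vertexFunctions :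
    Module.finrank K (G.vertexFunctions t) = Nat.card G.VertexOrbit := by
  rw [← range_vertexFunction, LinearMap.finrank_range_of_inj (G.vertexFunction_injective t),
    Module.finrank_pi, Nat.card_eq_fintype_card]

theorem finrank_componentFunctions_inv (ht : ¬ IsOfFinOrder t) :
    Module.finrank K (G.componentFunctions t⁻¹) = Module.finrank K (G.componentFunctions t) := by
  have ht' : ¬ IsOfFinOrder t⁻¹ := mt isOfFinOrder_inv_iff.1 ht
  exact Nat.add_right_cancel <|
    (finrank_twistedInvariants_add_ncard_windingOrbits G.commute_of_mem_rot_rev ht').trans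
      (finrank_twistedInvariants_add_ncard_windingOrbits G.commute_of_mem_rot_rev ht).symm

theorem finrank_edgeFunctions_add_finrank_componentFunctions_le (ht : ¬ IsOfFinOrder t) :
    Module.finrank K (G.edgeFunctions t) + 2 * Module.finrank K (G.componentFunctions t) ≤
      Module.finrank K (G.vertexFunctions t) + Module.finrank K (G.faceFunctions t) := by
  have hface : Module.finrank K (G.faceFunctions t) + _ = _ :=
    finrank_twistedInvariants_add_ncard_windingOrbits G.commute_of_mem_face ht
  have hcomp : Module.finrank K (G.componentFunctions t) + _ = _ :=
    finrank_twistedInvariants_add_ncard_windingOrbits G.commute_of_mem_rot_rev ht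
  have hwind := ncard_windingOrbits_face_le G
  have heuler : Nat.card G.VertexOrbit + Nat.card (JointOrbits G.shiftD {G.rot * G.rev}) =
      Nat.card (JointOrbits G.shiftD {G.rev}) +
        2 * Nat.card (JointOrbits G.shiftD {G.rot, G.rev}) := G.euler
  rw [G.finrank_edgeFunctions ht, finrank_vertexFunctions]
  omega

theorem edgeFunctions_inf_vertexFunctions :
    G.edgeFunctions t ⊓ G.vertexFunctions t = G.componentFunctions t := by
  refine le_antisymm (fun f hf => ⟨hf.1.1, ?_⟩)
    (le_inf (twistedInvariants_anti (by simp)) (twistedInvariants_anti (by simp)))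
  rintro _ (rfl | rfl)
  · exact hf.2.2 _ rfl
  · exact hf.1.2 _ rfl

theorem faceFunction_apply_rev {g : D → K} (hg : g ∈ G.faceFunctions t) (d : D) :
    g (G.rev d) = g (G.rot d) := by
  rw [← hg.2 _ rfl, Equiv.Perm.mul_apply, G.rev_rev]

theorem mem_componentFunctions_of_coboundary_eq_zero [CharP K 2] {g : D → K}
    (hg : g ∈ G.faceFunctions t) (hg0 : G.coboundary K g = 0) : g ∈ G.componentFunctions t := by
  refine ⟨hg.1, ?_⟩
  have hrev := G.coboundary_eq_zero_iff.1 hg0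
  rintro _ (rfl | rfl) d
  · rw [← G.faceFunction_apply_rev hg, hrev]
  · exact hrev d

theorem finrank_faceFunctions_le [CharP K 2] (ht : ¬ IsOfFinOrder t) :
    Module.finrank K (G.faceFunctions t) ≤
      Module.finrank K ((G.faceFunctions t).map (G.coboundary K)) +
        Module.finrank K (G.componentFunctions t) := by
  have := finiteDimensional_twistedInvariants G.commute_of_mem_face ht
  have := finiteDimensional_twistedInvariants G.commute_of_mem_rot_rev ht
  let δ := (G.coboundary K).domRestrict (G.faceFunctions t)
  have hker : (LinearMap.ker δ).map (G.faceFunctions t).subtype ≤ G.componentFunctions t := by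
    rintro _ ⟨g, hg, rfl⟩
    exact G.mem_componentFunctions_of_coboundary_eq_zero g.2 hg
  have hle := Submodule.finrank_mono hker
  rw [Submodule.finrank_map_subtype_eq] at hle
  rw [← LinearMap.range_domRestrict, ← LinearMap.finrank_range_add_finrank_ker δ]
  exact Nat.add_le_add_left hle _

variable (t) in
/-- The edge functions whose values at the darts issuing from each vertex sum to zero: the cycles
of the quotient graph. The condition is expressed by orthogonality to vertex functions. -/
def cycles : Submodule K (D → K) where
  carrier := {η | η ∈ G.edgeFunctions t ∧
    ∀ w ∈ G.vertexFunctions t⁻¹, orbitSum G.shiftD (fun d => η d * w d) = 0}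
  zero_mem' := ⟨Submodule.zero_mem _, fun w _ => by simp [orbitSum]⟩
  add_mem' := fun hη hθ => ⟨Submodule.add_mem _ hη.1 hθ.1, fun w hw => by
    have h := congrArg₂ (· + ·) (hη.2 w hw) (hθ.2 w hw)
    simpa only [orbitSum, ← Finset.sum_add_distrib, ← add_mul, add_zero, Pi.add_apply] using h⟩
  smul_mem' := fun a _ hη => ⟨Submodule.smul_mem _ a hη.1, fun w hw => by
    have h := congrArg (a * ·) (hη.2 w hw)
    simpa only [orbitSum, Finset.mul_sum, ← mul_assoc, mul_zero, Pi.smul_apply, smul_eq_mul]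
      using h⟩

theorem cycles_le_edgeFunctions : G.cycles t ≤ G.edgeFunctions t := fun _ hη => hη.1

/-- In characteristic two, edge functions are orthogonal to edge functions, hence cycles are
orthogonal to the span of vertex and edge functions. -/
theorem finrank_cycles_add_le [CharP K 2] (ht : ¬ IsOfFinOrder t) :
    Module.finrank K (G.cycles t) + Module.finrank K (G.edgeFunctions t) +
        Module.finrank K (G.vertexFunctions t) ≤
      Nat.card G.DartOrbit + Module.finrank K (G.componentFunctions t) := by
  have ht' : ¬ IsOfFinOrder t⁻¹ := mt isOfFinOrder_inv_iff.1 ht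
  have := finiteDimensional_twistedInvariants G.commute_of_mem_rev ht'
  have := finiteDimensional_twistedInvariants G.commute_of_mem_rot ht'
  have horth : ∀ η ∈ G.cycles t, ∀ u ∈ G.edgeFunctions t⁻¹ ⊔ G.vertexFunctions t⁻¹,
      orbitSum G.shiftD (fun d => η d * u d) = 0 := by
    intro η hη u hu
    obtain ⟨θ, hθ, w, hw, rfl⟩ := Submodule.mem_sup.1 hu
    have h := congrArg₂ (· + ·) (G.orbitSum_edgeFunction_mul_eq_zero hη.1 hθ) (hη.2 w hw)
    simpa only [orbitSum, ← Finset.sum_add_distrib, ← mul_add, add_zero, Pi.add_apply] using h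
  have hle : _ ≤ Fintype.card G.DartOrbit := finrank_add_finrank_le_of_orthogonal
    (sup_le (twistedInvariants_anti (Set.empty_subset _))
      (twistedInvariants_anti (Set.empty_subset _)))
    (G.cycles_le_edgeFunctions.trans (twistedInvariants_anti (Set.empty_subset _))) horth
  have hsup := Submodule.finrank_sup_add_finrank_inf_eq (G.edgeFunctions t⁻¹)
    (G.vertexFunctions t⁻¹)
  rw [edgeFunctions_inf_vertexFunctions, G.finrank_componentFunctions_inv ht,
    G.finrank_edgeFunctions ht', finrank_vertexFunctions] at hsup
  rw [G.finrank_edgeFunctions ht, finrank_vertexFunctions,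
    Nat.card_eq_fintype_card (α := G.DartOrbit)]
  omega

theorem coboundary_faceFunction_mem_cycles [CharP K 2] {g : D → K} (hg : g ∈ G.faceFunctions t) :
    G.coboundary K g ∈ G.cycles t := by
  have hg' : g ∈ twistedInvariants G.shiftD ∅ t := twistedInvariants_anti (Set.empty_subset _) hg
  refine ⟨G.coboundary_mem_edgeFunctions hg', fun w hw => ?_⟩
  simp only [PeriodicGraph.coboundary_apply, G.faceFunction_apply_rev hg]
  exact orbitSum_add_apply_mul_eq_zero G.commute_rot_shiftD hg' hw

/-- Every cycle is the coboundary of a face function: by Euler's formula, both spaces have the same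
dimension. -/
theorem map_coboundary_faceFunctions [CharP K 2] (ht : ¬ IsOfFinOrder t) :
    (G.faceFunctions t).map (G.coboundary K) = G.cycles t := by
  have := finiteDimensional_twistedInvariants G.commute_of_mem_rev ht
  have := Submodule.finiteDimensional_of_le (G.cycles_le_edgeFunctions (t := t))
  refine Submodule.eq_of_le_of_finrank_le
    (Submodule.map_le_iff_le_comap.2 fun g hg => G.coboundary_faceFunction_mem_cycles hg) ?_
  have hcycles := G.finrank_cycles_add_le ht
  have hface := G.finrank_faceFunctions_le ht
  have heuler := G.finrank_edgeFunctions_add_finrank_componentFunctions_le ht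
  have hdarts := G.card_dartOrbit_le
  rw [← G.finrank_edgeFunctions ht] at hdarts
  omega

end Functions

end PlanePeriodicGraph

namespace PlanePeriodicGraph

section DehnColorings

variable {V D K : Type*} (G : PlanePeriodicGraph V D)

theorem medialDiagram_next_next (h : D × Bool) :
    G.medialDiagram.next (G.medialDiagram.next h) = (G.rev h.1, h.2) := by
  rcases h with ⟨d, _ | _⟩ <;> rfl

/-- The translation of the half-edges of the medial diagram. -/
def shiftHalfEdge : Equiv.Perm (D × Bool) := G.shiftD.prodCongr (Equiv.refl Bool)

theorem shiftHalfEdge_apply (h : D × Bool) : G.shiftHalfEdge h = (G.shiftD h.1, h.2) := rfl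

theorem commute_of_mem_strandMoves :
    ∀ σ ∈ G.medialDiagram.strandMoves, Commute σ G.shiftHalfEdge := by
  rintro _ (rfl | rfl)
  · ext1 ⟨d, _ | _⟩
    · exact Prod.ext (Equiv.congr_fun G.commute_rot_shiftD.inv_left.eq d) rfl
    · exact Prod.ext (G.rot_shift d) rfl
  · ext1 h
    simp only [Equiv.Perm.mul_apply, medialDiagram_next_next, shiftHalfEdge_apply, G.rev_shift]

theorem shiftHalfEdge_zpow_apply (n : ℤ) (h : D × Bool) :
    (G.shiftHalfEdge ^ n) h = ((G.shiftD ^ n) h.1, h.2) :=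
  Prod.ext (apply_zpow_of_semiconj (f := Prod.fst) (fun _ => rfl) n h)
    ((apply_zpow_of_semiconj (f := Prod.snd) (r := 1) (fun _ => rfl) n h).trans
      (by rw [one_zpow, Equiv.Perm.one_apply]))

theorem eq_zero_of_shiftHalfEdge_zpow_eq (n : ℤ) (h : D × Bool)
    (hn : (G.shiftHalfEdge ^ n) h = h) : n = 0 :=
  G.eq_zero_of_shiftD_zpow_eq (congrArg Prod.fst ((G.shiftHalfEdge_zpow_apply n h).symm.trans hn))

instance finite_halfEdgeOrbits :
    Finite (Quotient (Equiv.Perm.SameCycle.setoid G.shiftHalfEdge)) := by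
  refine Finite.of_surjective (α := G.DartOrbit × Bool)
    (fun p => Quotient.mk _ (p.1.out, p.2)) ?_
  rintro ⟨d, b⟩
  obtain ⟨n, hn⟩ := Quotient.mk_out (s := Equiv.Perm.SameCycle.setoid G.shiftD) d
  exact ⟨(Quotient.mk _ d, b), Quotient.sound ⟨n, by rw [shiftHalfEdge_zpow_apply, hn]⟩⟩

variable [Field K] {t : Kˣ}

variable (t) in
/-- The functions on the components of the link of the medial diagram, with values in the local
system of monodromy `t`, as functions on half-edges. -/
abbrev linkFunctions : Submodule K (D × Bool → K) :=
  twistedInvariants G.shiftHalfEdge G.medialDiagram.strandMoves t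

theorem mem_linkFunctions_iff {c : D × Bool → K} :
    c ∈ G.linkFunctions t ↔ (∀ d b, c (G.shiftD d, b) = t * c (d, b)) ∧
      (∀ d, c (G.rot d, false) = c (d, true)) ∧ ∀ d b, c (G.rev d, b) = c (d, b) := by
  constructor
  · rintro ⟨hshift, hinv⟩
    refine ⟨fun d b => hshift (d, b), fun d => hinv _ (Or.inl rfl) (d, true), fun d b => ?_⟩
    rw [← hinv _ (Or.inr rfl) (d, b), Equiv.Perm.mul_apply, medialDiagram_next_next]
  · rintro ⟨hshift, hrot, hrev⟩
    refine ⟨fun h => hshift h.1 h.2, ?_⟩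
    rintro _ (rfl | rfl) h
    · rcases h with ⟨d, _ | _⟩
      · have hd := hrot (G.rot.symm d)
        rw [Equiv.apply_symm_apply] at hd
        exact hd.symm
      · exact hrot d
    · rw [Equiv.Perm.mul_apply, medialDiagram_next_next]
      exact hrev h.1 h.2

/-- The coloring of the half-edges of the medial diagram obtained by adding the values of a function
`f` on the regions at the vertices of the graph and of a function `g` on its faces: the half-edge on
the right of a dart `d` separates `tail d` from the face on the right of `d`, the one on the left
separates it from the face on the right of `rev d`. -/
def dehnColoring (f g : D → K) (h : D × Bool) : K := f h.1 + g (if h.2 then G.rev h.1 else h.1)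

theorem dehnColoring_true (f g : D → K) (d : D) :
    G.dehnColoring f g (d, true) = f d + g (G.rev d) := rfl

theorem dehnColoring_false (f g : D → K) (d : D) :
    G.dehnColoring f g (d, false) = f d + g d := rfl

/-- At the crossing in the middle of an edge, the colors agree along the strands if and only if the
coboundaries agree. -/
theorem dehnColoring_mem_linkFunctions [CharP K 2] {f g : D → K} (hf : f ∈ G.vertexFunctions t)
    (hg : g ∈ G.faceFunctions t) (hfg : G.coboundary K f = G.coboundary K g) :
    G.dehnColoring f g ∈ G.linkFunctions t := by
  have hcross : ∀ d, f (G.rev d) + g d = f d + g (G.rev d) := fun d => by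
    have h := congrFun hfg d
    rw [PeriodicGraph.coboundary_apply, PeriodicGraph.coboundary_apply] at h
    linear_combination h - (f d - g d) * CharTwo.two_eq_zero (R := K)
  refine G.mem_linkFunctions_iff.2 ⟨?_, fun d => ?_, ?_⟩
  · rintro d (_ | _)
    · rw [dehnColoring_false, dehnColoring_false, hf.1, hg.1, mul_add]
    · rw [dehnColoring_true, dehnColoring_true, G.rev_shift, hf.1, hg.1, mul_add]
  · rw [dehnColoring_false, dehnColoring_true, hf.2 _ rfl, G.faceFunction_apply_rev hg]
  · rintro d (_ | _)
    · rw [dehnColoring_false, dehnColoring_false]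
      linear_combination hcross d + (g (G.rev d) - g d) * CharTwo.two_eq_zero (R := K)
    · rw [dehnColoring_true, dehnColoring_true, G.rev_rev, hcross]

theorem halfEdge_sum_mem_cycles [CharP K 2] {c : D × Bool → K} (hc : c ∈ G.linkFunctions t) :
    (fun d => c (d, false) + c (d, true)) ∈ G.cycles t := by
  obtain ⟨hshift, hrot, hrev⟩ := G.mem_linkFunctions_iff.1 hc
  refine ⟨⟨fun d => ?_, ?_⟩, fun w hw => ?_⟩
  · simp only [hshift, mul_add]
  · rintro _ rfl d
    simp only [hrev]
  · simp only [← hrot]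
    exact orbitSum_add_apply_mul_eq_zero (g := fun d => c (d, false)) G.commute_rot_shiftD
      ⟨fun d => hshift d false, fun _ h => h.elim⟩ hw

theorem exists_dehnColoring_eq [CharP K 2] (ht : ¬ IsOfFinOrder t) {c : D × Bool → K}
    (hc : c ∈ G.linkFunctions t) :
    ∃ f ∈ G.vertexFunctions t, ∃ g ∈ G.faceFunctions t,
      G.coboundary K f = G.coboundary K g ∧ G.dehnColoring f g = c := by
  have hcycle := G.halfEdge_sum_mem_cycles hc
  obtain ⟨hshift, hrot, hrev⟩ := G.mem_linkFunctions_iff.1 hc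
  rw [← G.map_coboundary_faceFunctions ht] at hcycle
  obtain ⟨g, hg, hgc⟩ := hcycle
  have hg_add : ∀ d, g d + g (G.rev d) = c (d, false) + c (d, true) := congrFun hgc
  refine ⟨fun d => c (d, false) + g d, ⟨fun d => ?_, ?_⟩, g, hg, ?_, ?_⟩
  · simp only [hshift, hg.1, mul_add]
  · rintro _ rfl d
    simp only [hrot]
    rw [← G.faceFunction_apply_rev hg]
    linear_combination hg_add d + (c (d, true) - g d) * CharTwo.two_eq_zero (R := K)
  · funext d
    rw [PeriodicGraph.coboundary_apply, PeriodicGraph.coboundary_apply, hrev]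
    linear_combination c (d, false) * CharTwo.two_eq_zero (R := K)
  · funext ⟨d, b⟩
    cases b
    · rw [dehnColoring_false]
      linear_combination g d * CharTwo.two_eq_zero (R := K)
    · rw [dehnColoring_true]
      linear_combination hg_add d + c (d, false) * CharTwo.two_eq_zero (R := K)

variable (t) in
/-- The vertex functions whose coboundary is a cycle: the kernel of the twisted Laplacian. -/
abbrev harmonicFunctions : Submodule K (D → K) :=
  G.vertexFunctions t ⊓ (G.cycles t).comap (G.coboundary K)

theorem componentFunctions_le_harmonicFunctions [CharP K 2] :
    G.componentFunctions t ≤ G.harmonicFunctions t := by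
  rw [← edgeFunctions_inf_vertexFunctions]
  refine fun f hf => ⟨hf.2, ?_⟩
  change G.coboundary K f ∈ G.cycles t
  rw [G.coboundary_eq_zero_iff.2 (hf.1.2 _ rfl)]
  exact Submodule.zero_mem _

theorem exists_harmonicFunction_ne_zero_iff [CharP K 2] (ht : ¬ IsOfFinOrder t) :
    (∃ f ∈ G.harmonicFunctions t, f ≠ 0) ↔ ∃ c ∈ G.linkFunctions t, c ≠ 0 := by
  constructor
  · rintro ⟨f, ⟨hf, hcycle⟩, hne⟩
    by_cases hf0 : G.coboundary K f = 0
    · refine ⟨_, G.dehnColoring_mem_linkFunctions hf (Submodule.zero_mem _) (by rw [hf0, map_zero]),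
        fun h => hne (funext fun d => ?_)⟩
      simpa only [dehnColoring_false, Pi.zero_apply, add_zero] using congrFun h (d, false)
    · rw [← G.map_coboundary_faceFunctions ht] at hcycle
      obtain ⟨g, hg, hgf⟩ := hcycle
      refine ⟨_, G.dehnColoring_mem_linkFunctions hf hg hgf.symm, fun h => hf0 ?_⟩
      rw [← hgf]
      refine funext fun d => ?_
      have hfalse := congrFun h (d, false)
      have htrue := congrFun h (d, true)
      rw [dehnColoring_false, Pi.zero_apply] at hfalse
      rw [dehnColoring_true, Pi.zero_apply] at htrue
      rw [PeriodicGraph.coboundary_apply, Pi.zero_apply]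
      linear_combination hfalse + htrue - f d * CharTwo.two_eq_zero (R := K)
  · rintro ⟨c, hc, hne⟩
    obtain ⟨f, hf, g, hg, hfg, rfl⟩ := G.exists_dehnColoring_eq ht hc
    by_cases hf0 : f = 0
    · refine ⟨g, G.componentFunctions_le_harmonicFunctions
        (G.mem_componentFunctions_of_coboundary_eq_zero hg (by rw [← hfg, hf0, map_zero])),
        fun hg0 => hne (funext fun h => ?_)⟩
      simp only [dehnColoring, hf0, hg0, Pi.zero_apply, add_zero]
    · have hcycle : G.coboundary K f ∈ G.cycles t :=
        hfg ▸ G.coboundary_faceFunction_mem_cycles hg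
      exact ⟨f, ⟨hf, hcycle⟩, hf0⟩

end DehnColorings

end PlanePeriodicGraph

namespace PeriodicGraph

section TwistedLaplacian

variable {V D K : Type*} (G : PeriodicGraph V D) [Field K] (t : Kˣ)

/-- The Laplacian matrix evaluated at `x = t`. -/
noncomputable def twistedLaplacian : Matrix G.VertexOrbit G.VertexOrbit K :=
  G.laplacian.map (LaurentPolynomial.eval₂ (Int.castRingHom K) t)

open Classical in
theorem twistedLaplacian_apply (i j : G.VertexOrbit) :
    G.twistedLaplacian t i j = (if i = j then (G.signedDegree i : K) else 0) -
      ∑ q : G.DartOrbit,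
        if G.vertexOrbit (G.tail q.out) = i ∧ G.vertexOrbit (G.tail (G.rev q.out)) = j then
          ((G.sign q.out : ℤ) : K) * (t ^ G.voltage q.out : Kˣ)
        else 0 := by
  simp only [twistedLaplacian, laplacian, adjacency, Matrix.map_apply, Matrix.sub_apply,
    Matrix.diagonal_apply, map_sub, map_sum,
    apply_ite (LaurentPolynomial.eval₂ (Int.castRingHom K) t), map_zero, map_mul, eq_intCast,
    map_intCast, LaurentPolynomial.eval₂_T]

open Classical in
theorem twistedLaplacian_mulVec_apply (a : G.VertexOrbit → K) (i : G.VertexOrbit) :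
    (G.twistedLaplacian t).mulVec a i =
      ∑ q : G.DartOrbit, if G.vertexOrbit (G.tail q.out) = i then
        ((G.sign q.out : ℤ) : K) * (a (G.vertexOrbit (G.tail q.out)) -
          (t ^ G.voltage q.out : Kˣ) * a (G.vertexOrbit (G.tail (G.rev q.out))))
      else 0 := by
  have hdegree : (G.signedDegree i : K) * a i = ∑ q : G.DartOrbit,
      if G.vertexOrbit (G.tail q.out) = i then
        ((G.sign q.out : ℤ) : K) * a (G.vertexOrbit (G.tail q.out)) else 0 := by
    rw [signedDegree, Int.cast_sum, Finset.sum_mul]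
    refine Finset.sum_congr rfl fun q _ => ?_
    split_ifs with h
    · rw [h]
    · rw [Int.cast_zero, zero_mul]
  simp only [Matrix.mulVec, dotProduct, twistedLaplacian_apply, sub_mul, Finset.sum_sub_distrib,
    ite_mul, zero_mul, Finset.sum_ite_eq, Finset.mem_univ, if_true, Finset.sum_mul, ite_and]
  rw [Finset.sum_comm, hdegree, ← Finset.sum_sub_distrib]
  refine Finset.sum_congr rfl fun q _ => ?_
  split_ifs with h
  · rw [Finset.sum_ite_eq, if_pos (Finset.mem_univ _), mul_sub, mul_assoc]
  · rw [Finset.sum_const_zero, sub_zero]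

theorem dotProduct_twistedLaplacian_mulVec (a b : G.VertexOrbit → K) :
    b ⬝ᵥ (G.twistedLaplacian t).mulVec a = orbitSum G.shiftD fun d =>
      ((G.sign d : ℤ) : K) * (G.vertexFunction t a d - G.vertexFunction t a (G.rev d)) *
        G.vertexFunction t⁻¹ b d := by
  classical
  simp only [dotProduct, twistedLaplacian_mulVec_apply, Finset.mul_sum, mul_ite, mul_zero]
  rw [Finset.sum_comm, orbitSum]
  refine Finset.sum_congr rfl fun q _ => ?_
  rw [Finset.sum_ite_eq, if_pos (Finset.mem_univ _)]
  simp only [vertexFunction, LinearMap.coe_mk, AddHom.coe_mk, voltage, zpow_sub, inv_zpow,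
    Units.val_mul, Units.val_inv_eq_inv_val]
  field_simp

end TwistedLaplacian

end PeriodicGraph

namespace PlanePeriodicGraph

section Harmonic

variable {V D K : Type*} (G : PlanePeriodicGraph V D) [Field K] [CharP K 2] (t : Kˣ)

theorem dotProduct_twistedLaplacian_mulVec_eq_orbitSum_coboundary (a b : G.VertexOrbit → K) :
    b ⬝ᵥ (G.twistedLaplacian t).mulVec a = orbitSum G.shiftD fun d =>
      G.coboundary K (G.vertexFunction t a) d * G.vertexFunction t⁻¹ b d := by
  have hsign : ∀ u : ℤˣ, ((u : ℤ) : K) = 1 := fun u => by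
    rcases Int.units_eq_one_or u with rfl | rfl <;> simp [CharTwo.neg_eq]
  simp only [G.dotProduct_twistedLaplacian_mulVec, hsign, one_mul, CharTwo.sub_eq_add,
    PeriodicGraph.coboundary_apply]

theorem vertexFunction_mem_harmonicFunctions_iff (a : G.VertexOrbit → K) :
    G.vertexFunction t a ∈ G.harmonicFunctions t ↔ (G.twistedLaplacian t).mulVec a = 0 := by
  have hmem : ∀ (u : Kˣ) (b : G.VertexOrbit → K), G.vertexFunction u b ∈ G.vertexFunctions u :=
    fun u b => G.range_vertexFunction (t := u) ▸ LinearMap.mem_range_self _ b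
  rw [← dotProduct_eq_zero_iff]
  constructor
  · rintro ⟨-, hcycle⟩ b
    rw [dotProduct_comm, dotProduct_twistedLaplacian_mulVec_eq_orbitSum_coboundary]
    exact hcycle.2 _ (hmem t⁻¹ b)
  · refine fun h => ⟨hmem t a, G.coboundary_mem_edgeFunctions
      (twistedInvariants_anti (Set.empty_subset _) (hmem t a)), fun w hw => ?_⟩
    rw [← range_vertexFunction] at hw
    obtain ⟨b, rfl⟩ := hw
    rw [← dotProduct_twistedLaplacian_mulVec_eq_orbitSum_coboundary, dotProduct_comm, h]

theorem exists_harmonicFunction_ne_zero_iff_eval₂_laplacianPolynomial :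
    (∃ f ∈ G.harmonicFunctions t, f ≠ 0) ↔
      LaurentPolynomial.eval₂ (Int.castRingHom K) t G.laplacianPolynomial = 0 := by
  classical
  have hdet : LaurentPolynomial.eval₂ (Int.castRingHom K) t G.laplacianPolynomial =
      (G.twistedLaplacian t).det := RingHom.map_det _ _
  rw [hdet, ← Matrix.exists_mulVec_eq_zero_iff]
  constructor
  · rintro ⟨f, hf, hne⟩
    have hrange := hf.1
    rw [← range_vertexFunction] at hrange
    obtain ⟨a, rfl⟩ := hrange
    exact ⟨a, fun ha => hne (by rw [ha, map_zero]),
      (G.vertexFunction_mem_harmonicFunctions_iff t a).1 hf⟩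
  · rintro ⟨a, hne, ha⟩
    exact ⟨_, (G.vertexFunction_mem_harmonicFunctions_iff t a).2 ha,
      fun h => hne (G.vertexFunction_injective t (h.trans (map_zero _).symm))⟩

end Harmonic

end PlanePeriodicGraph

theorem mainTheorem10 {V D : Type*} (G : PlanePeriodicGraph V D) :
    List.TFAE [
      ∃ K : G.medialDiagram.Component, K.IsClosed,
      Infinite (G.medialDiagram.colorings (ZMod 2)),
      AddMonoidAlgebra.mapRingHom ℤ (Int.castRingHom (ZMod 2)) G.laplacianPolynomial = 0] := by
  have hclosed := G.medialDiagram.exists_isClosed_iff_exists_not_isWinding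
    G.commute_of_mem_strandMoves G.eq_zero_of_shiftHalfEdge_zpow_eq
  tfae_have 1 ↔ 2 := by
    rw [hclosed, LinkDiagram.infinite_colorings_iff, G.medialDiagram.componentEquiv.infinite_iff,
      infinite_orbits_iff_exists_not_isWinding G.commute_of_mem_strandMoves]
  tfae_have 1 ↔ 3 := by
    obtain ⟨t, hinj⟩ := exists_unit_injective_eval₂ (ZMod 2)
    have ht := not_isOfFinOrder_of_injective_eval₂ hinj
    have : CharP (FractionRing (LaurentPolynomial (ZMod 2))) 2 :=
      charP_of_injective_algebraMap (algebraMap (ZMod 2) _).injective 2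
    rw [hclosed, ← exists_twistedInvariant_ne_zero_iff G.commute_of_mem_strandMoves ht,
      ← G.exists_harmonicFunction_ne_zero_iff ht,
      G.exists_harmonicFunction_ne_zero_iff_eval₂_laplacianPolynomial, ← map_eq_zero_iff _ hinj,
      eval₂_mapRingHom, RingHom.ext_int (Int.castRingHom _) _]
  tfae_finish
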